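/- **Setting.** Consider $x_{k+1}=Ax_k+Bu_k+Dw_k$ with $x_k\in\mathbb R^{n}$, $u_k\in\mathbb R^{m}$, $w_k\in\mathbb R^{p}$. Let $\mathbf W\subseteq\mathbb R^{p}$ be bounded with $0\in\operatorname{int}\mathbf W$. Let $w_0,w_1,\dots$ be i.i.d. with law $\mu$, where $\mu$ is supported in $\mathbf W$ (that is, $w_k\in\mathbf W$ almost surely), has mean zero, is non-singular (not singular with respect to Lebesgue measure), and satisfies $\mathbb P\{\|w_k\|\le\lambda\}>0$ for all $\lambda>0$. Let $\mathbf Z\subseteq\mathbb R^{n}\times\mathbb R^{m}$ be convex and compact with $0\in\operatorname{int}\mathbf Z$. Let $Q\succeq0$, $R\succ0$, $P\succ0$ with $(A,Q^{1/2})$ detectable, and suppose that $$P=Q+A^\top PA-K^\top(R+B^\top PB)K,\qquad K=-(R+B^\top PB)^{-1}B^\top PA .$$ Suppose that $(A+BK,D)$ is controllable. Let $\mathbf X_f\subseteq\mathbb R^n$ be a nonempty closed set such that, for all $x\in\mathbf X_f$, $(x,Kx)\in\mathbf Z$ and $(A+BK)x+Dw\in\mathbf X_f$ for all $w\in\mathbf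 W$. Fix a horizon $N\ge1$. For a state $x$, consider the problem of minimizing $$J=\mathbb E\Bigl\{x_N^\top Px_N+\sum_{i=0}^{N-1}\bigl(x_i^\top Qx_i+u_i^\top Ru_i\bigr)\Bigr\}$$ over $v_i\in\mathbb R^m$ and $M_{i,j}\in\mathbb R^{m\times p}$ ($0\le j<i\le N-1$), where $x_0=x$, $x_{i+1}=Ax_i+Bu_i+Dw_i$, $u_i=v_i+\sum_{j=0}^{i-1}M_{i,j}w_j$, and the expectation is over i.i.d. $w_0,\dots,w_{N-1}$ with law $\mu$, subject to $(x_i,u_i)\in\mathbf Z$ for $0\le i\le N-1$ and $x_N\in\mathbf X_f$ for all $(w_0,\dots,w_{N-1})\in\mathbf W^N$. Let $\mathbf X$ be the set of all $x$ for which this problem is feasible and, for each $x\in\mathbf X$, let $v_0^*(x)$ be the first open-loop input $v_0$ of an optimal solution. Put $$g(x)=Ax+Bv_0^*(x),\qquad f(x,w)=g(x)+Dw,$$ so that the closed loop is $x_{k+1}=f(x_k,w_k)$, and suppose that $g$ is continuous on $\mathbf X$. **Proposition.** The map $g$ sends $\mathbf X$ into $\mathbf X$, $g(0)=0$, and the following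 three assumptions hold for the closed loop. 1. *(Disturbance.)* $\{w_k\}$ is a zero-mean i.i.d. sequence with a non-singular law supported in $\mathbf W$, which is bounded and contains $0$ in its interior; and $\mathbb P\{\|w_k\|\le\lambda\}>0$ for all $\lambda>0$. 2. *(Linear terminal mode.)* $\mathbf X_f\subseteq\mathbf X$ is bounded, contains $0$ in its interior, and for all $x\in\mathbf X_f$ and $w\in\mathbf W$: $f(x,w)\in\mathbf X_f$ and $f(x,w)=(A+BK)x+Dw$. Moreover $A+BK$ is Schur stable and $(A+BK,D)$ is controllable. 3. *(ISS-Lyapunov function.)* $\mathbf X$ contains $0$ in its interior, $f(x,w)\in\mathbf X$ for all $x\in\mathbf X$, $w\in\mathbf W$, and there are a continuous $V:\mathbf X\to\mathbb R_+$, $\mathcal K_\infty$-functions $\alpha_1,\alpha_2,\alpha_3$ and a $\mathcal K$-function $\sigma$ such that, for all $x\in\mathbf X$ and $w\in\mathbf W$, $$\alpha_1(\|x\|)\le V(x)\le\alpha_2(\|x\|),\qquad V(f(x,w))-V(x)\le-\alpha_3(\|x\|)+\sigma(\|w\|).$$ Here a $\mathcal K$-function is a continuous strictly increasing $\phi:\mathbb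 R_+\to\mathbb R_+$ with $\phi(0)=0$; it is a $\mathcal K_\infty$-function if also $\phi(s)\to\infty$ as $s\to\infty$. -/

import Mathlib

open MeasureTheory ProbabilityTheory Filter
open scoped NNReal Matrix

noncomputable section

namespace StochMPC

/-- The Euclidean space `ℝⁿ`. -/
abbrev Vec (n : ℕ) : Type := EuclideanSpace ℝ (Fin n)

/-- The matrix-vector product `M x`, on Euclidean spaces. -/
def act {a b : ℕ} (M : Matrix (Fin a) (Fin b) ℝ) (x : Vec b) : Vec a :=
  Matrix.toEuclideanLin M x

/-- The quadratic form `xᵀ S x`. -/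
def quad {a : ℕ} (S : Matrix (Fin a) (Fin a) ℝ) (x : Vec a) : ℝ :=
  inner ℝ x (act S x)

/-! ### Comparison functions -/

/-- Class `𝒦`: continuous, strictly increasing functions `ℝ₊ → ℝ₊` vanishing at `0`. -/
structure IsClassK (φ : ℝ≥0 → ℝ≥0) : Prop where
  continuous : Continuous φ
  strictMono : StrictMono φ
  map_zero : φ 0 = 0

/-- Class `𝒦∞`: unbounded functions of class `𝒦`. -/
structure IsClassKInf (φ : ℝ≥0 → ℝ≥0) : Prop extends IsClassK φ where
  tendsto_atTop : Tendsto φ atTop atTop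

/-! ### Linear systems notions -/

/-- Schur stability: every complex eigenvalue lies in the open unit disc. -/
def IsSchurStable {n : ℕ} (A : Matrix (Fin n) (Fin n) ℝ) : Prop :=
  ∀ z ∈ spectrum ℂ (A.map (algebraMap ℝ ℂ)), ‖z‖ < 1

/-- The controllability matrix `[D, AD, …, Aⁿ⁻¹D]`. -/
def controllabilityMatrix {n p : ℕ} (A : Matrix (Fin n) (Fin n) ℝ)
    (D : Matrix (Fin n) (Fin p) ℝ) : Matrix (Fin n) (Fin n × Fin p) ℝ :=
  Matrix.of fun i kj => (A ^ (kj.1 : ℕ) * D) i kj.2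

/-- `(A, D)` is controllable: the controllability matrix has full row rank. -/
def IsControllable {n p : ℕ} (A : Matrix (Fin n) (Fin n) ℝ)
    (D : Matrix (Fin n) (Fin p) ℝ) : Prop :=
  (controllabilityMatrix A D).rank = n

/-- `(A, C)` is detectable: some output injection `L` makes `A + L C` Schur stable. -/
def IsDetectable {n q : ℕ} (A : Matrix (Fin n) (Fin n) ℝ)
    (C : Matrix (Fin q) (Fin n) ℝ) : Prop :=
  ∃ L : Matrix (Fin n) (Fin q) ℝ, IsSchurStable (A + L * C)

/-! ### The general nonlinear setting `x⁺ = f(x, w) = g(x) + D w` on a state space `X` -/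

/-- The map `f(x, w) = g(x) + D w`. -/
def nextState {n p : ℕ} (g : Vec n → Vec n) (D : Matrix (Fin n) (Fin p) ℝ)
    (x : Vec n) (w : Vec p) : Vec n :=
  g x + act D w

/-- `g` is a continuous map of `X` into itself that fixes the origin. -/
structure IsDrift {n : ℕ} (X : Set (Vec n)) (g : Vec n → Vec n) : Prop where
  mapsTo : Set.MapsTo g X X
  continuousOn : ContinuousOn g X
  map_zero : g 0 = 0

/-- `S` is robustly invariant for `x⁺ = f(x, w)`, `w ∈ W`. -/
def IsRobustlyInvariant {n p : ℕ} (f : Vec n → Vec p → Vec n) (W : Set (Vec p))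
    (S : Set (Vec n)) : Prop :=
  ∀ x ∈ S, ∀ w ∈ W, f x w ∈ S

/-- The disturbance assumption: `w` is a zero-mean i.i.d. sequence whose law is non-singular
(that is, not singular with respect to Lebesgue measure) and supported in the bounded set `W`,
which contains the origin in its interior; small disturbances have positive probability. -/
structure DisturbanceAssumption {Ω : Type*} [MeasurableSpace Ω] (Pr : Measure Ω) {p : ℕ}
    (W : Set (Vec p)) (w : ℕ → Ω → Vec p) : Prop where
  measurable : ∀ k, Measurable (w k)
  indep : iIndepFun w Pr
  identDistrib : ∀ k, IdentDistrib (w k) (w 0) Pr Pr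
  integrable : ∀ k, Integrable (w k) Pr
  zero_mean : ∀ k, ∫ ω, w k ω ∂Pr = 0
  nonsingular : ∀ k, ¬ (Pr.map (w k)) ⟂ₘ volume
  supported : ∀ k, ∀ᵐ ω ∂Pr, w k ω ∈ W
  bounded : Bornology.IsBounded W
  zero_mem_interior : (0 : Vec p) ∈ interior W
  small_ball : ∀ k, ∀ r : ℝ, 0 < r → 0 < Pr {ω | ‖w k ω‖ ≤ r}

/-- The terminal mode assumption, with terminal set `Xf` and terminal dynamics
`x⁺ = Acl x + D w`. -/
structure LinearTerminalMode {n p : ℕ} (X : Set (Vec n)) (W : Set (Vec p))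
    (g : Vec n → Vec n) (D : Matrix (Fin n) (Fin p) ℝ)
    (Xf : Set (Vec n)) (Acl : Matrix (Fin n) (Fin n) ℝ) : Prop where
  subset : Xf ⊆ X
  bounded : Bornology.IsBounded Xf
  zero_mem_interior : (0 : Vec n) ∈ interior Xf
  robustlyInvariant : IsRobustlyInvariant (nextState g D) W Xf
  linear : ∀ x ∈ Xf, ∀ w ∈ W, nextState g D x w = act Acl x + act D w
  schur : IsSchurStable Acl
  controllable : IsControllable Acl D

/-- `V` is an ISS-Lyapunov function on `X` for `x⁺ = f(x, w)`, `w ∈ W`. -/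
structure IsISSLyapunov {n p : ℕ} (X : Set (Vec n)) (W : Set (Vec p))
    (f : Vec n → Vec p → Vec n) (V : Vec n → ℝ) : Prop where
  continuousOn : ContinuousOn V X
  nonneg : ∀ x ∈ X, 0 ≤ V x
  bounds : ∃ α₁ α₂ α₃ σ : ℝ≥0 → ℝ≥0,
    IsClassKInf α₁ ∧ IsClassKInf α₂ ∧ IsClassKInf α₃ ∧ IsClassK σ ∧
    (∀ x ∈ X, (α₁ ‖x‖₊ : ℝ) ≤ V x ∧ V x ≤ (α₂ ‖x‖₊ : ℝ)) ∧
    ∀ x ∈ X, ∀ w ∈ W, V (f x w) - V x ≤ -(α₃ ‖x‖₊ : ℝ) + (σ ‖w‖₊ : ℝ)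

/-- The Lyapunov assumption: the state space contains the origin in its interior and is robustly
invariant, and there is an ISS-Lyapunov function on it. -/
structure ISSLyapunovAssumption {n p : ℕ} (X : Set (Vec n)) (W : Set (Vec p))
    (f : Vec n → Vec p → Vec n) : Prop where
  zero_mem_interior : (0 : Vec n) ∈ interior X
  robustlyInvariant : IsRobustlyInvariant f W X
  exists_lyapunov : ∃ V : Vec n → ℝ, IsISSLyapunov X W f V

/-! ### Model predictive control with policies affine in the disturbance -/

/-- The data of the control problem: system matrices `A, B, D`, cost matrices `Q, R, P`, terminal
gain `K`, horizon `N`, constraint set `Z`, disturbance set `W`, terminal set `Xf`, and the law `μ`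
of a single disturbance. -/
structure Problem (n m p : ℕ) where
  A : Matrix (Fin n) (Fin n) ℝ
  B : Matrix (Fin n) (Fin m) ℝ
  D : Matrix (Fin n) (Fin p) ℝ
  Q : Matrix (Fin n) (Fin n) ℝ
  R : Matrix (Fin m) (Fin m) ℝ
  P : Matrix (Fin n) (Fin n) ℝ
  K : Matrix (Fin m) (Fin n) ℝ
  N : ℕ
  Z : Set (Vec n × Vec m)
  W : Set (Vec p)
  Xf : Set (Vec n)
  μ : ProbabilityMeasure (Vec p)

/-- The decision variables: open-loop inputs `v i` and disturbance gains `M i j`. Only the entries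
`v i` with `i < N` and `M i j` with `j < i < N` enter the control problem. -/
structure Policy (m p : ℕ) where
  v : ℕ → Vec m
  M : ℕ → ℕ → Matrix (Fin m) (Fin p) ℝ

/-- The predicted input `uᵢ = vᵢ + ∑_{j < i} M_{i,j} wⱼ`. -/
def Policy.input {m p : ℕ} (θ : Policy m p) (w : ℕ → Vec p) (i : ℕ) : Vec m :=
  θ.v i + ∑ j ∈ Finset.range i, act (θ.M i j) (w j)

namespace Problem

variable {n m p : ℕ} (S : Problem n m p)

/-- The predicted states: `x₀ = x` and `xᵢ₊₁ = A xᵢ + B uᵢ + D wᵢ`. -/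
def state (x : Vec n) (θ : Policy m p) (w : ℕ → Vec p) : ℕ → Vec n
  | 0 => x
  | i + 1 => act S.A (state x θ w i) + act S.B (θ.input w i) + act S.D (w i)

/-- `θ` is feasible at `x`: for all disturbances in `W`, the state and input constraints hold along
the horizon and the final predicted state lies in `Xf`. -/
def Feasible (x : Vec n) (θ : Policy m p) : Prop :=
  ∀ w : ℕ → Vec p, (∀ j, w j ∈ S.W) →
    (∀ i < S.N, (S.state x θ w i, θ.input w i) ∈ S.Z) ∧ S.state x θ w S.N ∈ S.Xf

/-- The cost of one disturbance realization. -/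
def pathCost (x : Vec n) (θ : Policy m p) (w : ℕ → Vec p) : ℝ :=
  quad S.P (S.state x θ w S.N) +
    ∑ i ∈ Finset.range S.N, (quad S.Q (S.state x θ w i) + quad S.R (θ.input w i))

/-- The expected cost `J`, the predicted disturbances being i.i.d. with law `μ`. -/
def cost (x : Vec n) (θ : Policy m p) : ℝ :=
  ∫ w, S.pathCost x θ w ∂(Measure.infinitePi fun _ : ℕ => (S.μ : Measure (Vec p)))

/-- `θ` is an optimal solution of the control problem at `x`. -/
def IsOptimal (x : Vec n) (θ : Policy m p) : Prop :=
  S.Feasible x θ ∧ ∀ θ' : Policy m p, S.Feasible x θ' → S.cost x θ ≤ S.cost x θ'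

/-- The closed-loop state space: the states at which the control problem is feasible. -/
def feasibleSet : Set (Vec n) :=
  {x | ∃ θ : Policy m p, S.Feasible x θ}

/-- The undisturbed closed loop `g(x) = A x + B v₀*(x)`, for a choice `x ↦ θ*(x)` of policies. -/
def drift (θs : Vec n → Policy m p) (x : Vec n) : Vec n :=
  act S.A x + act S.B ((θs x).v 0)

end Problem

end StochMPC

end

/-!
Write `H = R + Bᵀ P B`. By the Riccati equation, one step of the cost with terminal weight `P`
equals `xᵀ P x` plus the `H`-weighted square of the deviation `u - K x` (`Problem.IsRiccati.step`).
Along a predicted trajectory the states and inputs are affine in the past disturbances, hence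
uncorrelated with the present one, and the expected cost is `xᵀ P x` plus the sum of the second
moments of the deviations, plus a constant (`Problem.IsAdmissible.cost_eq`).
On the terminal set the feedback `u = K x` is feasible and has no deviation at all, so every optimal
solution starts with it.

The Lyapunov form of the Riccati equation and detectability make `A + B K` Schur stable
(`Problem.IsRiccati.isSchurStable`). Hence the closed invariant set `Xf` contains the origin, and by
controllability it contains the states reachable from the origin, which fill a neighbourhood.

Replanning after a disturbance `y`, that is, keeping the remaining inputs and appending the terminal
feedback, is feasible at `f(x, y)`. For `y = 0` it loses the first deviation and replaces the later
ones by their values with the first disturbance set to zero, which does not increase second moments.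
So the optimal value decreases by the stage cost along `g`
(`Problem.IsAdmissible.value_drift_le`). The stage cost need not be definite; adding the square of a
norm adapted to an observer matrix `A + L Q^{1/2}` produces a function that decreases by a multiple
of `‖x‖²`.

Neither `Xf` nor the feasible set need be convex, and the optimal value need not be continuous, so
it does not serve as the ISS-Lyapunov function. It is only used to show that all trajectories of `g`
are in `Xf` after a common time `T`. Since the feasible set is compact
(`Problem.IsAdmissible.isCompact_feasibleSet`) and `g` is continuous, the sum of `‖gᵏ x‖²` over
`k < T`, plus a multiple of the squared adapted norm of `g^T x` for `A + B K`, is a continuous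
Lyapunov function (`exists_continuous_lyapunov`). Its uniform continuity yields the gain `σ`
(`isISSLyapunov_of_isCompact`).
-/

namespace StochMPC

/-! ### The matrix action and quadratic forms -/

section Action

variable {a b c : ℕ}

@[simp] lemma act_zero (M : Matrix (Fin a) (Fin b) ℝ) : act M 0 = 0 := map_zero _

lemma act_add (M : Matrix (Fin a) (Fin b) ℝ) (x y : Vec b) : act M (x + y) = act M x + act M y :=
  map_add _ _ _

lemma act_sub (M : Matrix (Fin a) (Fin b) ℝ) (x y : Vec b) : act M (x - y) = act M x - act M y :=
  map_sub _ _ _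

lemma act_smul (M : Matrix (Fin a) (Fin b) ℝ) (r : ℝ) (x : Vec b) : act M (r • x) = r • act M x :=
  map_smul _ _ _

lemma act_sum {ι : Type*} (M : Matrix (Fin a) (Fin b) ℝ) (s : Finset ι) (f : ι → Vec b) :
    act M (∑ i ∈ s, f i) = ∑ i ∈ s, act M (f i) :=
  map_sum _ _ _

lemma add_act (M M' : Matrix (Fin a) (Fin b) ℝ) (x : Vec b) :
    act (M + M') x = act M x + act M' x := by
  simp [act]

@[simp] lemma zero_act (x : Vec b) : act (0 : Matrix (Fin a) (Fin b) ℝ) x = 0 := by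
  simp [act]

@[simp] lemma one_act (x : Vec a) : act (1 : Matrix (Fin a) (Fin a) ℝ) x = x := by
  ext i; simp [act]

lemma mul_act (M : Matrix (Fin a) (Fin b) ℝ) (M' : Matrix (Fin b) (Fin c) ℝ) (x : Vec c) :
    act (M * M') x = act M (act M' x) := by
  ext i; simp [act]

lemma neg_act (M : Matrix (Fin a) (Fin b) ℝ) (x : Vec b) : act (-M) x = -act M x := by
  simp [act]

lemma act_apply (M : Matrix (Fin a) (Fin b) ℝ) (x : Vec b) (i : Fin a) :
    act M x i = ∑ j, M i j * x j := by
  simp [act, Matrix.mulVec, dotProduct]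

lemma inner_act_left (M : Matrix (Fin a) (Fin b) ℝ) (x : Vec b) (y : Vec a) :
    inner ℝ (act M x) y = inner ℝ x (act Mᵀ y) := by
  have h := Matrix.toEuclideanLin_conjTranspose_eq_adjoint M
  rw [Matrix.conjTranspose_eq_transpose_of_trivial] at h
  rw [act, act, h, LinearMap.adjoint_inner_right]

@[fun_prop]
lemma continuous_act (M : Matrix (Fin a) (Fin b) ℝ) : Continuous (act M) :=
  (Matrix.toEuclideanLin M).continuous_of_finiteDimensional

/-- The matrix action is jointly continuous in the matrix and the vector. -/
@[fun_prop]
lemma continuous_act_act : Continuous fun q : Matrix (Fin a) (Fin b) ℝ × Vec b => act q.1 q.2 := by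
  have h : (fun q : Matrix (Fin a) (Fin b) ℝ × Vec b => act q.1 q.2) =
      fun q => WithLp.toLp 2 fun i => ∑ j, q.1 i j * q.2 j := by
    funext q; ext i; exact act_apply _ _ _
  rw [h]
  fun_prop

@[fun_prop]
lemma continuous_quad (S : Matrix (Fin a) (Fin a) ℝ) : Continuous (quad S) := by
  unfold quad; fun_prop

@[fun_prop]
lemma measurable_act (M : Matrix (Fin a) (Fin b) ℝ) : Measurable (act M) :=
  (continuous_act M).measurable

@[simp] lemma quad_zero (S : Matrix (Fin a) (Fin a) ℝ) : quad S 0 = 0 := by simp [quad]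

lemma quad_eq_dotProduct (S : Matrix (Fin a) (Fin a) ℝ) (x : Vec a) :
    quad S x = x.ofLp ⬝ᵥ (S *ᵥ x.ofLp) := by
  simp [quad, act, PiLp.inner_apply, dotProduct, mul_comm]

lemma quad_nonneg {S : Matrix (Fin a) (Fin a) ℝ} (hS : S.PosSemidef) (x : Vec a) :
    0 ≤ quad S x := by
  rw [quad_eq_dotProduct]
  simpa using hS.dotProduct_mulVec_nonneg x.ofLp

lemma quad_pos {S : Matrix (Fin a) (Fin a) ℝ} (hS : S.PosDef) {x : Vec a} (hx : x ≠ 0) :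
    0 < quad S x := by
  rw [quad_eq_dotProduct]
  have : x.ofLp ≠ 0 := fun h => hx (by ext i; simp [h])
  simpa using hS.dotProduct_mulVec_pos this

lemma quad_eq_zero {S : Matrix (Fin a) (Fin a) ℝ} (hS : S.PosDef) {x : Vec a} (hx : quad S x = 0) :
    x = 0 := by
  by_contra h
  exact (quad_pos hS h).ne' hx

lemma quad_add_matrix (S T : Matrix (Fin a) (Fin a) ℝ) (x : Vec a) :
    quad (S + T) x = quad S x + quad T x := by
  simp [quad, add_act, inner_add_right]

/-- The quadratic form of a congruence `Mᵀ S M`. -/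
lemma quad_congr (S : Matrix (Fin a) (Fin a) ℝ) (M : Matrix (Fin a) (Fin b) ℝ) (x : Vec b) :
    quad (Mᵀ * S * M) x = quad S (act M x) := by
  rw [quad, quad, mul_act, mul_act, ← inner_act_left]

lemma quad_add {S : Matrix (Fin a) (Fin a) ℝ} (hS : Sᵀ = S) (x y : Vec a) :
    quad S (x + y) = quad S x + 2 * inner ℝ x (act S y) + quad S y := by
  have : inner ℝ y (act S x) = inner ℝ x (act S y) := by
    rw [real_inner_comm, inner_act_left, hS]
  simp only [quad, act_add, inner_add_left, inner_add_right, this]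
  ring

/-- The form is invariant under the rotations and dilations which multiplication by
`α + i β` induces on pairs of real vectors, up to the factor `|α + i β|²`. -/
lemma quad_rotation (S : Matrix (Fin a) (Fin a) ℝ) (α β : ℝ) (x y : Vec a) :
    quad S (α • x - β • y) + quad S (β • x + α • y) =
      (α ^ 2 + β ^ 2) * (quad S x + quad S y) := by
  simp only [quad, act_add, act_sub, act_smul, inner_add_left, inner_add_right, inner_sub_left,
    inner_sub_right, inner_smul_left, inner_smul_right, conj_trivial]
  ring

lemma transpose_eq {S : Matrix (Fin a) (Fin a) ℝ} (hS : S.IsHermitian) : Sᵀ = S := by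
  rw [← Matrix.conjTranspose_eq_transpose_of_trivial]; exact hS

/-- A matrix is bounded as an operator, with a positive bound. -/
lemma exists_norm_act_le (M : Matrix (Fin a) (Fin b) ℝ) :
    ∃ C : ℝ, 0 < C ∧ ∀ x, ‖act M x‖ ≤ C * ‖x‖ := by
  obtain ⟨C, hC, h⟩ := (LinearMap.toContinuousLinearMap (Matrix.toEuclideanLin M)).bound
  exact ⟨C, hC, h⟩

lemma exists_norm_sq_le_quad {S : Matrix (Fin a) (Fin a) ℝ} (hS : S.PosDef) :
    ∃ C : ℝ, 0 < C ∧ ∀ x, ‖x‖ ^ 2 ≤ C * quad S x := by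
  rcases isEmpty_or_nonempty (Metric.sphere (0 : Vec a) 1) with h | h
  · refine ⟨1, one_pos, fun x => ?_⟩
    have hx : x = 0 := by
      by_contra hx
      exact h.false ⟨‖x‖⁻¹ • x, by simp [norm_smul, hx]⟩
    simp [hx]
  · obtain ⟨y, hy, hmin⟩ := (isCompact_sphere (0 : Vec a) 1).exists_isMinOn
      (Set.nonempty_coe_sort.mp h) (continuous_quad S).continuousOn
    have hy0 : y ≠ 0 := by rintro rfl; simp at hy
    have hpos := quad_pos hS hy0
    refine ⟨(quad S y)⁻¹, inv_pos.mpr hpos, fun x => ?_⟩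
    rcases eq_or_ne x 0 with rfl | hx
    · simp
    have hx' : 0 < ‖x‖ := norm_pos_iff.mpr hx
    have h1 : quad S y ≤ quad S (‖x‖⁻¹ • x) := hmin (by simp [norm_smul, hx])
    have h2 : quad S (‖x‖⁻¹ • x) = (‖x‖ ^ 2)⁻¹ * quad S x := by
      simp only [quad, act_smul, inner_smul_left, inner_smul_right, conj_trivial]
      ring
    rw [h2] at h1
    rw [← div_eq_inv_mul, le_div_iff₀ hpos]
    rwa [← div_eq_inv_mul, le_div_iff₀ (by positivity), mul_comm] at h1

end Action

/-! ### Schur stability -/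

section Schur

variable {n : ℕ}

/-- The eigenvalue equation for the complex vector `x + i y`, in real and imaginary parts. -/
lemma mem_spectrum_map_iff (M : Matrix (Fin n) (Fin n) ℝ) (z : ℂ) :
    z ∈ spectrum ℂ (M.map (algebraMap ℝ ℂ)) ↔
      ∃ x y : Vec n, (x ≠ 0 ∨ y ≠ 0) ∧ act M x = z.re • x - z.im • y ∧
        act M y = z.im • x + z.re • y := by
  rw [spectrum.mem_iff, Matrix.isUnit_iff_isUnit_det, isUnit_iff_ne_zero, not_not,
    ← Matrix.exists_mulVec_eq_zero_iff]
  have key : ∀ v : Fin n → ℂ,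
      ((algebraMap ℂ (Matrix (Fin n) (Fin n) ℂ) z - M.map (algebraMap ℝ ℂ)) *ᵥ v = 0 ↔
        ∀ i, z * v i = ∑ j, (M i j : ℂ) * v j) := by
    intro v
    rw [Matrix.sub_mulVec, sub_eq_zero, funext_iff, Algebra.algebraMap_eq_smul_one,
      Matrix.smul_mulVec, Matrix.one_mulVec]
    simp [Matrix.mulVec, dotProduct]
  simp only [key]
  constructor
  · rintro ⟨v, hv, h⟩
    refine ⟨WithLp.toLp 2 fun i => (v i).re, WithLp.toLp 2 fun i => (v i).im, ?_, ?_, ?_⟩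
    · by_contra! h0
      apply hv
      funext i
      apply Complex.ext
      · simpa using congrArg (fun u : Vec n => u i) h0.1
      · simpa using congrArg (fun u : Vec n => u i) h0.2
    · ext i
      have := congrArg Complex.re (h i)
      simp [Complex.mul_re] at this
      simp [act_apply, this]
    · ext i
      have := congrArg Complex.im (h i)
      simp [Complex.mul_im] at this
      simp [act_apply, ← this]
      ring
  · rintro ⟨x, y, h0, hx, hy⟩
    refine ⟨fun i => ⟨x i, y i⟩, ?_, ?_⟩
    · intro hv
      have hv' : ∀ i, x i = 0 ∧ y i = 0 := fun i => by
        have := congrFun hv i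
        exact ⟨congrArg Complex.re this, congrArg Complex.im this⟩
      rcases h0 with h0 | h0
      · exact h0 (by ext i; exact (hv' i).1)
      · exact h0 (by ext i; exact (hv' i).2)
    · intro i
      have hxi := congrArg (fun u : Vec n => u i) hx
      have hyi := congrArg (fun u : Vec n => u i) hy
      simp [act_apply] at hxi hyi
      apply Complex.ext
      · simp [Complex.mul_re, hxi]
      · simp [Complex.mul_im, hyi]; ring

/-- Some power of a Schur stable matrix is a contraction by the factor `1 / 2`. -/
lemma IsSchurStable.exists_iterate_norm_le {A : Matrix (Fin n) (Fin n) ℝ} (hA : IsSchurStable A) :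
    ∃ m : ℕ, 0 < m ∧ ∀ x, ‖(act A)^[m] x‖ ≤ 1 / 2 * ‖x‖ := by
  rcases Nat.eq_zero_or_pos n with rfl | hn
  · exact ⟨1, one_pos, fun x => by simp [Subsingleton.elim x 0]⟩
  have : Nonempty (Fin n) := ⟨⟨0, hn⟩⟩
  let e := Matrix.toEuclideanCLM (n := Fin n) (𝕜 := ℂ)
  set T := e (A.map (algebraMap ℝ ℂ)) with hT
  have hspec : spectrum ℂ T = spectrum ℂ (A.map (algebraMap ℝ ℂ)) :=
    AlgEquiv.spectrum_eq e _
  have hrad : spectralRadius ℂ T < (1 : ℝ≥0) :=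
    spectrum.spectralRadius_lt_of_forall_lt T fun z hz => hA z (hspec ▸ hz)
  obtain ⟨r, hr, hr1⟩ := ENNReal.lt_iff_exists_nnreal_btwn.mp hrad
  have hr1' : r < 1 := by exact_mod_cast hr1
  have hev := (spectrum.pow_nnnorm_pow_one_div_tendsto_nhds_spectralRadius T).eventually_lt_const hr
  have hpow : ∀ᶠ k : ℕ in atTop, r ^ k < 1 / 2 :=
    (tendsto_pow_atTop_nhds_zero_of_lt_one zero_le hr1').eventually_lt_const (by norm_num)
  obtain ⟨m, ⟨hm, hm2⟩, hm0⟩ := ((hev.and hpow).and (eventually_gt_atTop 0)).exists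
  have hTm : ‖T ^ m‖₊ ≤ 1 / 2 := by
    have h1 : (‖T ^ m‖₊ : ENNReal) ≤ (r : ENNReal) ^ (m : ℝ) := by
      have := ENNReal.rpow_le_rpow hm.le (Nat.cast_nonneg (α := ℝ) m)
      rwa [← ENNReal.rpow_mul, one_div, inv_mul_cancel₀ (by positivity), ENNReal.rpow_one] at this
    rw [ENNReal.rpow_natCast] at h1
    exact le_trans (by exact_mod_cast h1) hm2.le
  -- the isometric embedding of real into complex vectors intertwines `A` and `T`
  let J : Vec n → EuclideanSpace ℂ (Fin n) := fun x => WithLp.toLp 2 fun i => (x i : ℂ)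
  have hJ : ∀ x, ‖J x‖ = ‖x‖ := fun x => by
    simp [J, EuclideanSpace.norm_eq]
  have hJA : ∀ x, J (act A x) = T (J x) := fun x => by
    ext i
    simp [J, T, e, act_apply, Matrix.mulVec, dotProduct]
  have hJAk : ∀ k x, J ((act A)^[k] x) = (T ^ k) (J x) := by
    intro k x
    induction k with
    | zero => simp
    | succ k ih => rw [Function.iterate_succ_apply', hJA, ih, pow_succ']; rfl
  refine ⟨m, hm0, fun x => ?_⟩
  rw [← hJ, hJAk, ← hJ x]
  exact ((T ^ m).le_opNorm _).trans
    (mul_le_mul_of_nonneg_right (by exact_mod_cast hTm) (norm_nonneg _))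

/-- A subadditive function `q` with `‖x‖ ≤ q x ≤ C ‖x‖` which `A` contracts by the factor `c`. -/
structure IsAdaptedNorm (A : Matrix (Fin n) (Fin n) ℝ) (q : Vec n → ℝ) (c C : ℝ) : Prop where
  c_pos : 0 < c
  c_lt_one : c < 1
  C_pos : 0 < C
  norm_le : ∀ x, ‖x‖ ≤ q x
  le_norm : ∀ x, q x ≤ C * ‖x‖
  add_le : ∀ x y, q (x + y) ≤ q x + q y
  contract : ∀ x, q (act A x) ≤ c * q x
  continuous : Continuous q

/-- The sum of the norms of the first iterates, up to one which halves the norm, is adapted: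
applying `A` drops the term `‖x‖` and gains at most half of it. -/
lemma IsSchurStable.exists_adaptedNorm {A : Matrix (Fin n) (Fin n) ℝ} (hA : IsSchurStable A) :
    ∃ q c C, IsAdaptedNorm A q c C := by
  obtain ⟨m, hm, hhalf⟩ := hA.exists_iterate_norm_le
  have hadd : ∀ k x y, (act A)^[k] (x + y) = (act A)^[k] x + (act A)^[k] y := by
    intro k x y
    induction k with
    | zero => rfl
    | succ k ih => simp only [Function.iterate_succ_apply', ih, act_add]
  obtain ⟨a, ha, hab⟩ := exists_norm_act_le A
  have hbound : ∀ k x, ‖(act A)^[k] x‖ ≤ a ^ k * ‖x‖ := by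
    intro k x
    induction k with
    | zero => simp
    | succ k ih =>
      rw [Function.iterate_succ_apply', pow_succ', mul_assoc]
      exact (hab _).trans (mul_le_mul_of_nonneg_left ih ha.le)
  let q : Vec n → ℝ := fun x => ∑ k ∈ Finset.range m, ‖(act A)^[k] x‖
  let C : ℝ := ∑ k ∈ Finset.range m, a ^ k
  have hC1 : 1 ≤ C := by
    have := Finset.single_le_sum (f := fun k => a ^ k) (fun k _ => by positivity)
      (Finset.mem_range.mpr hm)
    simpa using this
  have hqC : ∀ x, q x ≤ C * ‖x‖ := fun x => by
    simp only [q, C, Finset.sum_mul]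
    exact Finset.sum_le_sum fun k _ => hbound k x
  have h1q : ∀ x, ‖x‖ ≤ q x := fun x => by
    have := Finset.single_le_sum (f := fun k => ‖(act A)^[k] x‖) (fun k _ => norm_nonneg _)
      (Finset.mem_range.mpr hm)
    simpa using this
  refine ⟨q, 1 - 1 / (2 * C), C, ?_, ?_, by linarith, h1q, hqC, ?_, ?_, ?_⟩
  · have : 1 / (2 * C) < 1 := by rw [div_lt_one (by positivity)]; linarith
    linarith
  · have : 0 < 1 / (2 * C) := by positivity
    linarith
  · intro x y
    simp only [q, ← Finset.sum_add_distrib, hadd]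
    exact Finset.sum_le_sum fun k _ => norm_add_le _ _
  · intro x
    have h1 : q (act A x) + ‖x‖ = q x + ‖(act A)^[m] x‖ := by
      simp only [q, ← Function.iterate_succ_apply]
      rw [← Finset.sum_range_succ (fun k => ‖(act A)^[k] x‖), Finset.sum_range_succ']
      simp
    have h2 : 1 / (2 * C) * q x ≤ 1 / 2 * ‖x‖ := by
      rw [one_div_mul_eq_div, div_le_iff₀ (by positivity)]
      nlinarith [hqC x]
    linarith [hhalf x]
  · refine continuous_finsetSum _ fun k _ => ((continuous_act A).iterate k).norm

end Schur

section AdaptedNorm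

variable {n : ℕ} {A : Matrix (Fin n) (Fin n) ℝ} {q : Vec n → ℝ} {c C : ℝ}

lemma IsAdaptedNorm.nonneg (h : IsAdaptedNorm A q c C) (x : Vec n) : 0 ≤ q x :=
  (norm_nonneg x).trans (h.norm_le x)

lemma IsAdaptedNorm.iterate_le (h : IsAdaptedNorm A q c C) (k : ℕ) (x : Vec n) :
    q ((act A)^[k] x) ≤ c ^ k * q x := by
  induction k with
  | zero => simp
  | succ k ih =>
    rw [Function.iterate_succ_apply', pow_succ', mul_assoc]
    exact (h.contract _).trans (mul_le_mul_of_nonneg_left ih h.c_pos.le)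

lemma IsSchurStable.tendsto_iterate (hA : IsSchurStable A) (x : Vec n) :
    Tendsto (fun k => (act A)^[k] x) atTop (nhds 0) := by
  obtain ⟨q, c, C, h⟩ := hA.exists_adaptedNorm
  refine squeeze_zero_norm (fun k => (h.norm_le _).trans (h.iterate_le k x)) ?_
  simpa using (tendsto_pow_atTop_nhds_zero_of_lt_one h.c_pos.le h.c_lt_one).mul_const (q x)

/-- The square of an adapted norm decreases up to a multiple of the squared perturbation: by
convexity of the square, `(c s + t)² ≤ c s² + t² / (1 - c)`. -/
lemma IsAdaptedNorm.sq_add_le (h : IsAdaptedNorm A q c C) (x e : Vec n) :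
    q (act A x + e) ^ 2 ≤ c * q x ^ 2 + C ^ 2 / (1 - c) * ‖e‖ ^ 2 := by
  have hc := h.c_pos
  have hc1 : 0 < 1 - c := sub_pos.mpr h.c_lt_one
  have h1 : q (act A x + e) ≤ c * q x + C * ‖e‖ :=
    (h.add_le _ _).trans (add_le_add (h.contract x) (h.le_norm e))
  have h2 : q (act A x + e) ^ 2 ≤ (c * q x + C * ‖e‖) ^ 2 :=
    pow_le_pow_left₀ (h.nonneg _) h1 2
  refine h2.trans ?_
  have h3 : C ^ 2 / (1 - c) * ‖e‖ ^ 2 = (C * ‖e‖) ^ 2 / (1 - c) := by ring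
  have h4 : c * q x ^ 2 + (C * ‖e‖) ^ 2 / (1 - c) - (c * q x + C * ‖e‖) ^ 2 =
      c * ((1 - c) * q x - C * ‖e‖) ^ 2 / (1 - c) := by
    field_simp
    ring
  have h5 : 0 ≤ c * ((1 - c) * q x - C * ‖e‖) ^ 2 / (1 - c) := by positivity
  rw [h3]
  linarith

end AdaptedNorm

/-! ### The Riccati equation -/

section Riccati

variable {n m p : ℕ} {S : Problem n m p}

/-- The weight `R + Bᵀ P B` of the deviations `u - K x` from the terminal feedback. -/
abbrev Problem.H (S : Problem n m p) : Matrix (Fin m) (Fin m) ℝ := S.R + S.Bᵀ * S.P * S.B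

/-- The closed-loop matrix `A + B K` of the terminal feedback. -/
abbrev Problem.Acl (S : Problem n m p) : Matrix (Fin n) (Fin n) ℝ := S.A + S.B * S.K

/-- The weights are definite and `P`, `K` solve the algebraic Riccati equation. -/
structure Problem.IsRiccati (S : Problem n m p) : Prop where
  posSemidef_Q : S.Q.PosSemidef
  posDef_R : S.R.PosDef
  posDef_P : S.P.PosDef
  riccati : S.P = S.Q + S.Aᵀ * S.P * S.A - S.Kᵀ * S.H * S.K
  gain : S.K = -(S.H⁻¹ * S.Bᵀ * S.P * S.A)

lemma Problem.act_Acl (S : Problem n m p) (x : Vec n) :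
    act S.Acl x = act S.A x + act S.B (act S.K x) := by
  rw [add_act, mul_act]

namespace Problem.IsRiccati

lemma posDef_H (h : S.IsRiccati) : S.H.PosDef := by
  refine h.posDef_R.add_posSemidef ?_
  have := h.posDef_P.posSemidef.conjTranspose_mul_mul_same S.B
  rwa [Matrix.conjTranspose_eq_transpose_of_trivial] at this

lemma transpose_P (h : S.IsRiccati) : S.Pᵀ = S.P := transpose_eq h.posDef_P.isHermitian

lemma transpose_R (h : S.IsRiccati) : S.Rᵀ = S.R := transpose_eq h.posDef_R.isHermitian

lemma H_mul_K (h : S.IsRiccati) : S.H * S.K = -(S.Bᵀ * S.P * S.A) := by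
  have hdet : IsUnit S.H.det := (Matrix.isUnit_iff_isUnit_det _).mp h.posDef_H.isUnit
  conv_lhs => rw [h.gain]
  rw [Matrix.mul_neg, Matrix.mul_assoc, Matrix.mul_assoc,
    Matrix.mul_nonsing_inv_cancel_left _ _ hdet, Matrix.mul_assoc]

/-- The Riccati equation in Lyapunov form. -/
lemma lyapunov (h : S.IsRiccati) :
    S.P = S.Q + S.Kᵀ * S.R * S.K + S.Aclᵀ * S.P * S.Acl := by
  have h1 := h.H_mul_K
  have h2 : S.Kᵀ * (S.Bᵀ * S.P * S.A) = -(S.Kᵀ * S.H * S.K) := by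
    rw [Matrix.mul_assoc S.Kᵀ S.H, h1, Matrix.mul_neg, neg_neg]
  have h3 : S.Aᵀ * S.P * S.B * S.K = -(S.Kᵀ * S.H * S.K) := by
    have := congrArg Matrix.transpose h2
    simp only [Matrix.transpose_mul, Matrix.transpose_transpose, Matrix.transpose_neg,
      h.transpose_P, transpose_eq h.posDef_H.isHermitian] at this
    simpa only [Matrix.mul_assoc] using this
  have h4 : S.Kᵀ * S.H * S.K = S.Kᵀ * S.R * S.K + S.Kᵀ * (S.Bᵀ * S.P * S.B) * S.K := by
    rw [Matrix.mul_add, Matrix.add_mul]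
  have h5 : S.Aclᵀ * S.P * S.Acl = S.Aᵀ * S.P * S.A + S.Aᵀ * S.P * S.B * S.K +
      S.Kᵀ * (S.Bᵀ * S.P * S.A) + S.Kᵀ * (S.Bᵀ * S.P * S.B) * S.K := by
    simp only [Problem.Acl, Matrix.transpose_add, Matrix.transpose_mul, Matrix.add_mul,
      Matrix.mul_add, Matrix.mul_assoc]
    abel
  have h6 := h.riccati
  rw [h5, h3, h2]
  rw [h4] at h6 ⊢
  conv_lhs => rw [h6]
  abel

lemma quad_lyapunov (h : S.IsRiccati) (x : Vec n) :
    quad S.P x = quad S.Q x + quad S.R (act S.K x) + quad S.P (act S.Acl x) := by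
  conv_lhs => rw [h.lyapunov]
  rw [quad_add_matrix, quad_add_matrix, quad_congr, quad_congr]

/-- Completion of squares: one step of the cost with terminal weight `P` exceeds its optimum
`xᵀ P x` by the `H`-weighted square of the deviation from the terminal feedback. -/
lemma step (h : S.IsRiccati) (x : Vec n) (u : Vec m) :
    quad S.Q x + quad S.R u + quad S.P (act S.A x + act S.B u) =
      quad S.P x + quad S.H (u - act S.K x) := by
  obtain ⟨d, rfl⟩ : ∃ d, u = d + act S.K x := ⟨u - act S.K x, by abel⟩
  have h1 : act S.A x + act S.B (d + act S.K x) = act S.B d + act S.Acl x := by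
    rw [act_Acl, act_add]; abel
  rw [h1, quad_add h.transpose_R, quad_add h.transpose_P, add_sub_cancel_right, quad_add_matrix,
    quad_congr, h.quad_lyapunov x]
  have h2 : inner ℝ d (act S.R (act S.K x)) + inner ℝ (act S.B d) (act S.P (act S.Acl x)) = 0 := by
    have h3 : S.R * S.K + S.Bᵀ * S.P * S.Acl = 0 := by
      have := h.H_mul_K
      rw [Matrix.add_mul] at this
      rw [Problem.Acl, Matrix.mul_add, ← Matrix.mul_assoc (S.Bᵀ * S.P), add_left_comm, this,
        add_neg_cancel]
    rw [inner_act_left, ← inner_add_right, ← mul_act, ← mul_act, ← mul_act, ← add_act, h3]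
    simp
  linarith

/-- Along an eigenvector of `A + B K` for an eigenvalue of modulus at least one the Lyapunov
equation forces `Q` and `K` to vanish, so that it is an eigenvector of every `A + L Q^{1/2}`. -/
lemma isSchurStable (h : S.IsRiccati) {Qh : Matrix (Fin n) (Fin n) ℝ} (hQh : Qh.PosSemidef)
    (hsq : Qh * Qh = S.Q) (hdet : IsDetectable S.A Qh) : IsSchurStable S.Acl := by
  intro z hz
  obtain ⟨L, hL⟩ := hdet
  obtain ⟨x, y, h0, hx, hy⟩ := (mem_spectrum_map_iff _ _).mp hz
  by_contra! hz1
  have hrot := quad_rotation S.P z.re z.im x y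
  rw [← hx, ← hy] at hrot
  have hnorm : 1 ≤ z.re ^ 2 + z.im ^ 2 := by
    have := Complex.sq_norm z
    rw [Complex.normSq_apply] at this
    nlinarith
  have hQ : ∀ v, quad S.Q v = ‖act Qh v‖ ^ 2 := fun v => by
    rw [← hsq, quad, mul_act, ← real_inner_self_eq_norm_sq, inner_act_left,
      transpose_eq hQh.isHermitian]
  have hPx := quad_nonneg h.posDef_P.posSemidef x
  have hPy := quad_nonneg h.posDef_P.posSemidef y
  have hRx := quad_nonneg h.posDef_R.posSemidef (act S.K x)
  have hRy := quad_nonneg h.posDef_R.posSemidef (act S.K y)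
  have hQx := quad_nonneg h.posSemidef_Q x
  have hQy := quad_nonneg h.posSemidef_Q y
  have hlx := h.quad_lyapunov x
  have hly := h.quad_lyapunov y
  have hge : quad S.P x + quad S.P y ≤ quad S.P (act S.Acl x) + quad S.P (act S.Acl y) := by
    rw [hrot]; nlinarith
  have hker : ∀ v, quad S.Q v = 0 → quad S.R (act S.K v) = 0 →
      act (S.A + L * Qh) v = act S.Acl v := by
    intro v h1 h2
    rw [hQ, sq_eq_zero_iff, norm_eq_zero] at h1
    rw [act_Acl, add_act, mul_act, h1, quad_eq_zero h.posDef_R h2]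
    simp
  have := hL z ((mem_spectrum_map_iff _ _).mpr ⟨x, y, h0,
    (hker x (by linarith) (by linarith)).trans hx, (hker y (by linarith) (by linarith)).trans hy⟩)
  linarith

/-- Detectability turns the stage cost into a bound on the state: along an adapted norm of an
observer matrix `A + L Q^{1/2}`, the output injection and the input act as perturbations which the
stage cost dominates. -/
lemma exists_storage (h : S.IsRiccati) {Qh : Matrix (Fin n) (Fin n) ℝ} (hQh : Qh.PosSemidef)
    (hsq : Qh * Qh = S.Q) (hdet : IsDetectable S.A Qh) :
    ∃ (q : Vec n → ℝ) (γ C Γ : ℝ), 0 < γ ∧ 0 < Γ ∧ 0 < C ∧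
      (∀ x, ‖x‖ ≤ q x) ∧ (∀ x, q x ≤ C * ‖x‖) ∧
      ∀ x u, q (act S.A x + act S.B u) ^ 2 ≤
        q x ^ 2 - γ * ‖x‖ ^ 2 + Γ * (quad S.Q x + quad S.R u) := by
  obtain ⟨L, hL⟩ := hdet
  obtain ⟨q, c, C, hq⟩ := hL.exists_adaptedNorm
  obtain ⟨l, hl, hlb⟩ := exists_norm_act_le L
  obtain ⟨b, hb, hbb⟩ := exists_norm_act_le S.B
  obtain ⟨r, hr, hrb⟩ := exists_norm_sq_le_quad h.posDef_R
  have hc1 : 0 < 1 - c := sub_pos.mpr hq.c_lt_one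
  have hC := hq.C_pos
  refine ⟨q, 1 - c, C, C ^ 2 / (1 - c) * (2 * l ^ 2 + 2 * b ^ 2 * r), hc1, by positivity, hC,
    hq.norm_le, hq.le_norm, fun x u => ?_⟩
  have hQ : quad S.Q x = ‖act Qh x‖ ^ 2 := by
    rw [← hsq, quad, mul_act, ← real_inner_self_eq_norm_sq, inner_act_left,
      transpose_eq hQh.isHermitian]
  have hRu := quad_nonneg h.posDef_R.posSemidef u
  have hsplit : act S.A x + act S.B u =
      act (S.A + L * Qh) x + (act S.B u - act L (act Qh x)) := by
    rw [add_act, mul_act]; abel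
  have h1 := hq.sq_add_le x (act S.B u - act L (act Qh x))
  rw [← hsplit] at h1
  have h2 : ‖act S.B u - act L (act Qh x)‖ ^ 2 ≤
      (2 * l ^ 2 + 2 * b ^ 2 * r) * (quad S.Q x + quad S.R u) := by
    have h3 : ‖act S.B u - act L (act Qh x)‖ ≤ b * ‖u‖ + l * ‖act Qh x‖ :=
      (norm_sub_le _ _).trans (add_le_add (hbb u) (hlb _))
    have h4 := pow_le_pow_left₀ (norm_nonneg _) h3 2
    have h5 : b ^ 2 * ‖u‖ ^ 2 ≤ b ^ 2 * (r * quad S.R u) :=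
      mul_le_mul_of_nonneg_left (hrb u) (by positivity)
    have h6 : 0 ≤ 2 * l ^ 2 * quad S.R u := by positivity
    have h7 : 0 ≤ 2 * b ^ 2 * r * quad S.Q x := by rw [hQ]; positivity
    have h8 := sq_nonneg (b * ‖u‖ - l * ‖act Qh x‖)
    rw [hQ] at h7 ⊢
    nlinarith
  have h9 : C ^ 2 / (1 - c) * ‖act S.B u - act L (act Qh x)‖ ^ 2 ≤
      C ^ 2 / (1 - c) * ((2 * l ^ 2 + 2 * b ^ 2 * r) * (quad S.Q x + quad S.R u)) :=
    mul_le_mul_of_nonneg_left h2 (by positivity)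
  have h10 : (1 - c) * ‖x‖ ^ 2 ≤ (1 - c) * q x ^ 2 :=
    mul_le_mul_of_nonneg_left (pow_le_pow_left₀ (norm_nonneg _) (hq.norm_le x) 2) hc1.le
  linarith

end Problem.IsRiccati

end Riccati

/-! ### Causal affine functions of the disturbance -/

section Causal

variable {k l p : ℕ}

/-- `f` is an affine function of the first `i` terms of the disturbance sequence. -/
def IsCausalAffine (i : ℕ) (f : (ℕ → Vec p) → Vec k) : Prop :=
  ∃ (a : Vec k) (G : ℕ → Matrix (Fin k) (Fin p) ℝ),
    ∀ w, f w = a + ∑ j ∈ Finset.range i, act (G j) (w j)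

/-- The sequence `w` preceded by `y`. -/
def cons (y : Vec p) (w : ℕ → Vec p) : ℕ → Vec p
  | 0 => y
  | j + 1 => w j

@[simp] lemma cons_zero (y : Vec p) (w : ℕ → Vec p) : cons y w 0 = y := rfl

@[simp] lemma cons_succ (y : Vec p) (w : ℕ → Vec p) (j : ℕ) : cons y w (j + 1) = w j := rfl

namespace IsCausalAffine

variable {i : ℕ} {f g : (ℕ → Vec p) → Vec k}

lemma const (i : ℕ) (a : Vec k) : IsCausalAffine i (fun _ : ℕ → Vec p => a) :=
  ⟨a, 0, fun w => by simp⟩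

lemma mono (hf : IsCausalAffine i f) {i' : ℕ} (h : i ≤ i') : IsCausalAffine i' f := by
  obtain ⟨a, G, hG⟩ := hf
  refine ⟨a, fun j => if j < i then G j else 0, fun w => ?_⟩
  rw [hG, ← Finset.sum_subset (Finset.range_mono h)]
  · congr 1
    exact Finset.sum_congr rfl fun j hj => by simp [Finset.mem_range.mp hj]
  · intro j _ hj
    simp [Finset.mem_range.not.mp hj]

lemma add (hf : IsCausalAffine i f) (hg : IsCausalAffine i g) :
    IsCausalAffine i (fun w => f w + g w) := by
  obtain ⟨a, G, hG⟩ := hf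
  obtain ⟨b, F, hF⟩ := hg
  refine ⟨a + b, G + F, fun w => ?_⟩
  simp only [hG, hF, Pi.add_apply, add_act, Finset.sum_add_distrib]
  abel

lemma act (hf : IsCausalAffine i f) (T : Matrix (Fin l) (Fin k) ℝ) :
    IsCausalAffine i (fun w => act T (f w)) := by
  obtain ⟨a, G, hG⟩ := hf
  refine ⟨StochMPC.act T a, fun j => T * G j, fun w => ?_⟩
  simp only [hG, act_add, act_sum, mul_act]

lemma act_coord (i : ℕ) (T : Matrix (Fin k) (Fin p) ℝ) :
    IsCausalAffine (i + 1) (fun w => StochMPC.act T (w i)) := by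
  refine ⟨0, fun j => if j = i then T else 0, fun w => ?_⟩
  rw [Finset.sum_range_succ, Finset.sum_eq_zero]
  · simp
  · intro j hj
    simp [(Finset.mem_range.mp hj).ne]

lemma sub (hf : IsCausalAffine i f) (hg : IsCausalAffine i g) :
    IsCausalAffine i (fun w => f w - g w) := by
  have := hf.add (hg.act (-1))
  simpa [neg_act, ← sub_eq_add_neg] using this

lemma comp_cons (hf : IsCausalAffine (i + 1) f) (y : Vec p) :
    IsCausalAffine i (fun w => f (cons y w)) := by
  obtain ⟨a, G, hG⟩ := hf
  refine ⟨a + StochMPC.act (G 0) y, fun j => G (j + 1), fun w => ?_⟩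
  simp only [hG, Finset.sum_range_succ', cons_succ, cons_zero]
  abel

end IsCausalAffine

/-- Policies realize every family of causal affine inputs. -/
lemma exists_policy_input_eq {m : ℕ} (u : ℕ → (ℕ → Vec p) → Vec m)
    (hu : ∀ i, IsCausalAffine i (u i)) :
    ∃ θ : Policy m p, ∀ w i, θ.input w i = u i w := by
  choose a G hG using hu
  exact ⟨⟨a, G⟩, fun w i => (hG i w).symm⟩

lemma isCausalAffine_input {m : ℕ} (θ : Policy m p) (i : ℕ) :
    IsCausalAffine i (fun w => θ.input w i) :=
  ⟨θ.v i, θ.M i, fun _ => rfl⟩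

lemma isCausalAffine_state {n m : ℕ} (S : Problem n m p) (x : Vec n) (θ : Policy m p) (i : ℕ) :
    IsCausalAffine i (fun w => S.state x θ w i) := by
  induction i with
  | zero => exact IsCausalAffine.const 0 x
  | succ i ih =>
    exact (((ih.act S.A).add ((isCausalAffine_input θ i).act S.B)).mono i.le_succ).add
      (IsCausalAffine.act_coord i S.D)

end Causal

/-! ### Second moments under independent centered disturbances -/

section Moments

variable {k l p : ℕ} {μ : Measure (Vec p)} [IsProbabilityMeasure μ]

/-- The law of a sequence of independent disturbances with common law `μ`. -/
noncomputable abbrev seqLaw (μ : Measure (Vec p)) [IsProbabilityMeasure μ] :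
    Measure (ℕ → Vec p) :=
  Measure.infinitePi fun _ : ℕ => μ

/-- A law with bounded support and mean zero. -/
structure IsBoundedCentered (μ : Measure (Vec p)) : Prop where
  bounded : ∃ r : ℝ, ∀ᵐ y ∂μ, ‖y‖ ≤ r
  mean_zero : ∫ y, y ∂μ = 0

lemma ae_seqLaw {P : Vec p → Prop} (h : ∀ᵐ y ∂μ, P y) : ∀ᵐ w ∂(seqLaw μ), ∀ j, P (w j) := by
  rw [ae_all_iff]
  intro j
  exact (measurePreserving_eval_infinitePi (fun _ : ℕ => μ) j).quasiMeasurePreserving.ae h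

lemma integral_seqLaw_eval (j : ℕ) {F : Vec p → ℝ} (hF : Measurable F) :
    ∫ w, F (w j) ∂(seqLaw μ) = ∫ y, F y ∂μ := by
  have h := measurePreserving_eval_infinitePi (fun _ : ℕ => μ) j
  conv_rhs => rw [← h.map_eq]
  rw [integral_map h.measurable.aemeasurable hF.aestronglyMeasurable]

namespace IsBoundedCentered

lemma integrable_id (hμ : IsBoundedCentered μ) : Integrable (fun y => y) μ := by
  obtain ⟨r, hr⟩ := hμ.bounded
  exact Integrable.of_bound measurable_id.aestronglyMeasurable r hr

end IsBoundedCentered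

namespace IsCausalAffine

variable {i : ℕ} {f : (ℕ → Vec p) → Vec k} {g : (ℕ → Vec p) → Vec k}

lemma measurable (hf : IsCausalAffine i f) : Measurable f := by
  obtain ⟨a, G, hG⟩ := hf
  rw [funext hG]
  fun_prop

lemma ae_bounded (hμ : IsBoundedCentered μ) (hf : IsCausalAffine i f) :
    ∃ C, ∀ᵐ w ∂(seqLaw μ), ‖f w‖ ≤ C := by
  obtain ⟨a, G, hG⟩ := hf
  obtain ⟨r, hr⟩ := hμ.bounded
  choose C hC hCb using fun j => exists_norm_act_le (G j)
  refine ⟨‖a‖ + ∑ j ∈ Finset.range i, C j * r, ?_⟩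
  filter_upwards [ae_seqLaw hr] with w hw
  rw [hG]
  refine (norm_add_le _ _).trans (add_le_add_right ((norm_sum_le _ _).trans ?_) _)
  exact Finset.sum_le_sum fun j _ =>
    (hCb j _).trans (mul_le_mul_of_nonneg_left (hw j) (hC j).le)

lemma integrable_inner (hμ : IsBoundedCentered μ) (hf : IsCausalAffine i f)
    {i' : ℕ} (hg : IsCausalAffine i' g) :
    Integrable (fun w => inner ℝ (f w) (g w)) (seqLaw μ) := by
  obtain ⟨C, hC⟩ := hf.ae_bounded hμ
  obtain ⟨C', hC'⟩ := hg.ae_bounded hμ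
  refine Integrable.of_bound (hf.measurable.inner hg.measurable).aestronglyMeasurable (C * C') ?_
  filter_upwards [hC, hC'] with w h1 h2
  exact (norm_inner_le_norm _ _).trans
    (mul_le_mul h1 h2 (norm_nonneg _) ((norm_nonneg _).trans h1))

lemma integrable_quad (hμ : IsBoundedCentered μ) (hf : IsCausalAffine i f)
    (S : Matrix (Fin k) (Fin k) ℝ) : Integrable (fun w => quad S (f w)) (seqLaw μ) :=
  hf.integrable_inner hμ (hf.act S)

end IsCausalAffine

lemma integral_inner_act (hμ : IsBoundedCentered μ) (T : Matrix (Fin k) (Fin p) ℝ) (a : Vec k) :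
    ∫ y, inner ℝ a (act T y) ∂μ = 0 := by
  have : ∀ y, inner ℝ a (act T y) = inner ℝ (act Tᵀ a) y := fun y => by
    rw [inner_act_left, Matrix.transpose_transpose]
  simp only [this]
  rw [integral_inner hμ.integrable_id, hμ.mean_zero, inner_zero_right]

/-- A causal affine function of the past is uncorrelated with the present disturbance. -/
lemma IsCausalAffine.integral_inner_act_eval (hμ : IsBoundedCentered μ) {i : ℕ}
    {f : (ℕ → Vec p) → Vec k} (hf : IsCausalAffine i f) (T : Matrix (Fin k) (Fin p) ℝ) :
    ∫ w, inner ℝ (f w) (StochMPC.act T (w i)) ∂(seqLaw μ) = 0 := by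
  have hpair : ∀ (G : Matrix (Fin k) (Fin p) ℝ) (j : ℕ), j ≠ i →
      ∫ w, inner ℝ (StochMPC.act G (w j)) (StochMPC.act T (w i)) ∂(seqLaw μ) = 0 := by
    intro G j hj
    let F : Vec p × Vec p → ℝ := fun y => inner ℝ (StochMPC.act G y.1) (StochMPC.act T y.2)
    have hFm : Measurable F := by
      exact ((measurable_act G).comp measurable_fst).inner ((measurable_act T).comp measurable_snd)
    have hmap := Measure.infinitePi_map_eval_prod (P := fun _ : ℕ => μ) hj
    have hmeas : Measurable fun w : ℕ → Vec p => (w j, w i) := by fun_prop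
    have hint : Integrable F (μ.prod μ) := by
      rw [← hmap, integrable_map_measure hFm.aestronglyMeasurable hmeas.aemeasurable]
      exact (IsCausalAffine.act_coord j G).integrable_inner hμ (IsCausalAffine.act_coord i T)
    have : ∫ w, F (w j, w i) ∂(seqLaw μ) = ∫ y, F y ∂(μ.prod μ) := by
      rw [← hmap, integral_map hmeas.aemeasurable hFm.aestronglyMeasurable]
    change ∫ w, F (w j, w i) ∂(seqLaw μ) = 0
    rw [this, integral_prod F hint]
    simp only [F, integral_inner_act hμ, integral_zero]
  obtain ⟨a, G, hG⟩ := hf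
  simp only [hG, inner_add_left, sum_inner]
  rw [integral_add, integral_finsetSum]
  · rw [Finset.sum_eq_zero fun j hj => hpair (G j) j (Finset.mem_range.mp hj).ne, add_zero,
      integral_seqLaw_eval i (F := fun y => inner ℝ a (StochMPC.act T y))
        (measurable_const.inner (measurable_act T)), integral_inner_act hμ]
  · exact fun j _ =>
      (IsCausalAffine.act_coord j (G j)).integrable_inner hμ (IsCausalAffine.act_coord i T)
  · exact (IsCausalAffine.const 0 a).integrable_inner hμ (IsCausalAffine.act_coord i T)
  · exact integrable_finsetSum _ fun j _ =>
      (IsCausalAffine.act_coord j (G j)).integrable_inner hμ (IsCausalAffine.act_coord i T)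

/-- The contributions of the disturbances to a second moment add up. -/
lemma integral_quad_affine (hμ : IsBoundedCentered μ) {H : Matrix (Fin k) (Fin k) ℝ}
    (hH : Hᵀ = H) (a : Vec k) (G : ℕ → Matrix (Fin k) (Fin p) ℝ) (i : ℕ) :
    ∫ w, quad H (a + ∑ j ∈ Finset.range i, act (G j) (w j)) ∂(seqLaw μ) =
      quad H a + ∑ j ∈ Finset.range i, ∫ y, quad H (act (G j) y) ∂μ := by
  induction i with
  | zero => simp
  | succ i ih =>
    have hf : IsCausalAffine i fun w : ℕ → Vec p =>
      a + ∑ j ∈ Finset.range i, act (G j) (w j) := ⟨a, G, fun _ => rfl⟩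
    have hg := IsCausalAffine.act_coord i (G i)
    have hexp : ∀ w : ℕ → Vec p, quad H (a + ∑ j ∈ Finset.range (i + 1), act (G j) (w j)) =
        quad H (a + ∑ j ∈ Finset.range i, act (G j) (w j)) +
          2 * inner ℝ (a + ∑ j ∈ Finset.range i, act (G j) (w j)) (act (H * G i) (w i)) +
          quad H (act (G i) (w i)) := fun w => by
      rw [Finset.sum_range_succ, ← add_assoc, quad_add hH, mul_act]
    simp only [hexp]
    have h1 := hf.integrable_quad hμ H
    have h2 := (hf.integrable_inner hμ (IsCausalAffine.act_coord i (H * G i))).const_mul 2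
    rw [integral_add (by exact h1.add h2) (hg.integrable_quad hμ H), integral_add h1 h2, ih,
      integral_const_mul, hf.integral_inner_act_eval hμ,
      integral_seqLaw_eval i (F := fun y => quad H (act (G i) y)) (by fun_prop),
      Finset.sum_range_succ]
    ring

/-- Conditioning on the first disturbance vanishing does not increase a second moment. -/
lemma IsCausalAffine.integral_quad_cons_zero_le (hμ : IsBoundedCentered μ)
    {H : Matrix (Fin k) (Fin k) ℝ} (hH : H.PosSemidef) {i : ℕ} {f : (ℕ → Vec p) → Vec k}
    (hf : IsCausalAffine (i + 1) f) :
    ∫ w, quad H (f (cons 0 w)) ∂(seqLaw μ) ≤ ∫ w, quad H (f w) ∂(seqLaw μ) := by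
  obtain ⟨a, G, hG⟩ := hf
  have hsym := transpose_eq hH.isHermitian
  simp only [hG]
  rw [integral_quad_affine hμ hsym]
  simp only [Finset.sum_range_succ', cons_succ, cons_zero, act_zero, add_zero]
  rw [integral_quad_affine hμ hsym a (fun j => G (j + 1))]
  have : 0 ≤ ∫ y, quad H (StochMPC.act (G 0) y) ∂μ := integral_nonneg fun y => quad_nonneg hH _
  linarith

end Moments

/-! ### The cost and the shifted policies -/

section Cost

variable {n m p : ℕ}

/-- The standing assumptions of the control problem. Schur stability of `A + B K` takes the place of
detectability, from which it follows by `Problem.IsRiccati.isSchurStable`. -/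
structure Problem.IsAdmissible (S : Problem n m p) : Prop extends S.IsRiccati where
  horizon_pos : 0 < S.N
  schur : IsSchurStable S.Acl
  controllable : IsControllable S.Acl S.D
  isCompact_Z : IsCompact S.Z
  nonempty_Xf : S.Xf.Nonempty
  isClosed_Xf : IsClosed S.Xf
  constraint_Xf : ∀ x ∈ S.Xf, (x, act S.K x) ∈ S.Z
  invariant_Xf : ∀ x ∈ S.Xf, ∀ w ∈ S.W, act S.A x + act S.B (act S.K x) + act S.D w ∈ S.Xf
  zero_mem_W : (0 : Vec p) ∈ interior S.W
  isBounded_W : Bornology.IsBounded S.W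
  ae_mem_W : ∀ᵐ y ∂(S.μ : Measure (Vec p)), y ∈ S.W
  mean_zero : ∫ y, y ∂(S.μ : Measure (Vec p)) = 0

namespace Problem

variable (S : Problem n m p)

/-- The deviation `uᵢ - K xᵢ` from the terminal feedback. -/
noncomputable def deviation (x : Vec n) (θ : Policy m p) (i : ℕ) (w : ℕ → Vec p) : Vec m :=
  θ.input w i - act S.K (S.state x θ w i)

/-- The expected `H`-weighted square deviation from the terminal feedback: up to a constant, the
excess of the cost over `xᵀ P x`. -/
noncomputable def excess (x : Vec n) (θ : Policy m p) : ℝ :=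
  ∑ i ∈ Finset.range S.N, ∫ w, quad S.H (S.deviation x θ i w) ∂(seqLaw (S.μ : Measure (Vec p)))

variable {S}

lemma isCausalAffine_deviation (x : Vec n) (θ : Policy m p) (i : ℕ) :
    IsCausalAffine i (S.deviation x θ i) :=
  (isCausalAffine_input θ i).sub ((isCausalAffine_state S x θ i).act S.K)

lemma deviation_zero (x : Vec n) (θ : Policy m p) (w : ℕ → Vec p) :
    S.deviation x θ 0 w = θ.v 0 - act S.K x := by
  simp [deviation, Policy.input, state]

lemma IsAdmissible.isBoundedCentered (h : S.IsAdmissible) :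
    IsBoundedCentered (S.μ : Measure (Vec p)) := by
  obtain ⟨r, hr⟩ := h.isBounded_W.exists_norm_le
  exact ⟨⟨r, h.ae_mem_W.mono fun y hy => hr y hy⟩, h.mean_zero⟩

lemma excess_nonneg (h : S.IsRiccati) (x : Vec n) (θ : Policy m p) : 0 ≤ S.excess x θ :=
  Finset.sum_nonneg fun _ _ => integral_nonneg fun _ => quad_nonneg h.posDef_H.posSemidef _

/-- Completion of squares along a path. -/
lemma IsRiccati.pathCost_eq (h : S.IsRiccati) (x : Vec n) (θ : Policy m p) (w : ℕ → Vec p) (k : ℕ) :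
    quad S.P (S.state x θ w k) +
        ∑ i ∈ Finset.range k, (quad S.Q (S.state x θ w i) + quad S.R (θ.input w i)) =
      quad S.P x + ∑ i ∈ Finset.range k, (quad S.H (S.deviation x θ i w) +
        2 * inner ℝ (act S.A (S.state x θ w i) + act S.B (θ.input w i))
          (act (S.P * S.D) (w i)) + quad S.P (act S.D (w i))) := by
  induction k with
  | zero => simp [state]
  | succ k ih =>
    have h1 := h.step (S.state x θ w k) (θ.input w k)
    rw [Finset.sum_range_succ, Finset.sum_range_succ, state, quad_add h.transpose_P, ← mul_act]
    simp only [deviation] at ih ⊢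
    linarith

/-- The cost is `xᵀ P x` plus the excess, up to a constant. -/
lemma IsAdmissible.cost_eq (h : S.IsAdmissible) (x : Vec n) (θ : Policy m p) :
    S.cost x θ = quad S.P x + S.excess x θ +
      S.N * ∫ y, quad S.P (act S.D y) ∂(S.μ : Measure (Vec p)) := by
  have hμ := h.isBoundedCentered
  have h1 : ∀ i, Integrable (fun w => quad S.H (S.deviation x θ i w))
      (seqLaw (S.μ : Measure (Vec p))) := fun i =>
    (isCausalAffine_deviation x θ i).integrable_quad hμ S.H
  have hy : ∀ i, IsCausalAffine i fun w =>
      act S.A (S.state x θ w i) + act S.B (θ.input w i) := fun i =>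
    ((isCausalAffine_state S x θ i).act S.A).add ((isCausalAffine_input θ i).act S.B)
  have h2 : ∀ i, Integrable (fun w : ℕ → Vec p => 2 * inner ℝ
      (act S.A (S.state x θ w i) + act S.B (θ.input w i)) (act (S.P * S.D) (w i)))
      (seqLaw (S.μ : Measure (Vec p))) := fun i =>
    ((hy i).integrable_inner hμ (IsCausalAffine.act_coord i (S.P * S.D))).const_mul 2
  have h3 : ∀ i, Integrable (fun w : ℕ → Vec p => quad S.P (act S.D (w i)))
      (seqLaw (S.μ : Measure (Vec p))) := fun i =>
    (IsCausalAffine.act_coord i S.D).integrable_quad hμ S.P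
  have h12 := fun i => (h1 i).add (h2 i)
  have h123 := fun i => (h12 i).add (h3 i)
  simp only [cost, pathCost, h.pathCost_eq]
  rw [integral_add (integrable_const _) (integrable_finsetSum _ fun i _ => by exact h123 i),
    integral_finsetSum _ fun i _ => by exact h123 i]
  have h4 : ∀ i, ∫ w, (quad S.H (S.deviation x θ i w) +
        2 * inner ℝ (act S.A (S.state x θ w i) + act S.B (θ.input w i))
          (act (S.P * S.D) (w i)) + quad S.P (act S.D (w i)))
        ∂(seqLaw (S.μ : Measure (Vec p))) =
      ∫ w, quad S.H (S.deviation x θ i w) ∂(seqLaw (S.μ : Measure (Vec p))) +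
        ∫ y, quad S.P (act S.D y) ∂(S.μ : Measure (Vec p)) := fun i => by
    rw [integral_add (by exact h12 i) (h3 i), integral_add (h1 i) (h2 i), integral_const_mul,
      (hy i).integral_inner_act_eval hμ,
      integral_seqLaw_eval i (F := fun y => quad S.P (act S.D y)) (by fun_prop)]
    ring
  rw [Finset.sum_congr rfl fun i _ => h4 i, Finset.sum_add_distrib]
  simp [excess]
  ring

lemma IsAdmissible.excess_le_of_isOptimal (h : S.IsAdmissible) {x : Vec n} {θ θ' : Policy m p}
    (hθ : S.IsOptimal x θ) (hθ' : S.Feasible x θ') : S.excess x θ ≤ S.excess x θ' := by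
  have := hθ.2 θ' hθ'
  rw [h.cost_eq, h.cost_eq] at this
  linarith

/-- The policy that replans after the disturbance `y`: it keeps the remaining inputs and ends with
the terminal feedback. -/
lemma exists_shift (S : Problem n m p) (x : Vec n) (θ : Policy m p) (y : Vec p) :
    ∃ θ' : Policy m p, (∀ w i, i + 1 < S.N → θ'.input w i = θ.input (cons y w) (i + 1)) ∧
      ∀ w i, i + 1 = S.N → θ'.input w i = act S.K (S.state x θ (cons y w) (i + 1)) := by
  obtain ⟨θ', hθ'⟩ := exists_policy_input_eq (p := p)
    (fun i w => if i + 1 < S.N then θ.input (cons y w) (i + 1)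
      else act S.K (S.state x θ (cons y w) (i + 1))) fun i => by
    by_cases hi : i + 1 < S.N
    · simpa only [hi, if_true] using (isCausalAffine_input θ (i + 1)).comp_cons y
    · simpa only [hi, if_false] using ((isCausalAffine_state S x θ (i + 1)).act S.K).comp_cons y
  refine ⟨θ', fun w i hi => ?_, fun w i hi => ?_⟩
  · rw [hθ', if_pos hi]
  · rw [hθ', if_neg (by omega)]

lemma state_shift {x : Vec n} {θ θ' : Policy m p} {y : Vec p}
    (h : ∀ w i, i + 1 < S.N → θ'.input w i = θ.input (cons y w) (i + 1)) (w : ℕ → Vec p) (i : ℕ)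
    (hi : i < S.N) :
    S.state (act S.A x + act S.B (θ.v 0) + act S.D y) θ' w i = S.state x θ (cons y w) (i + 1) := by
  induction i with
  | zero => simp [state, Policy.input]
  | succ i ih =>
    rw [state, ih (by omega), h w i hi]
    rfl

lemma IsAdmissible.feasible_shift (h : S.IsAdmissible) {x : Vec n} {θ θ' : Policy m p} {y : Vec p}
    (hθ : S.Feasible x θ) (hy : y ∈ S.W)
    (h1 : ∀ w i, i + 1 < S.N → θ'.input w i = θ.input (cons y w) (i + 1))
    (h2 : ∀ w i, i + 1 = S.N → θ'.input w i = act S.K (S.state x θ (cons y w) (i + 1))) :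
    S.Feasible (act S.A x + act S.B (θ.v 0) + act S.D y) θ' := by
  intro w hw
  obtain ⟨hZ, hXf⟩ := hθ (cons y w) (by rintro (_ | j); exacts [hy, hw j])
  constructor
  · intro i hi
    rw [state_shift h1 w i hi]
    rcases Nat.lt_or_ge (i + 1) S.N with hi' | hi'
    · rw [h1 w i hi']
      exact hZ (i + 1) hi'
    · have hi'' : i + 1 = S.N := by omega
      rw [h2 w i hi'', hi'']
      exact h.constraint_Xf _ hXf
  · obtain ⟨M, hM⟩ := Nat.exists_eq_succ_of_ne_zero h.horizon_pos.ne'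
    rw [hM, state, state_shift h1 w M (by omega), h2 w M hM.symm]
    have := h.invariant_Xf _ hXf (w M) (hw M)
    rwa [hM] at this

/-- Replanning after a vanishing disturbance saves the first deviation: the later ones are
conditioned on the first disturbance being zero, which does not increase their second moments, and
the new last one vanishes. -/
lemma IsAdmissible.excess_shift_le (h : S.IsAdmissible) {x : Vec n} {θ θ' : Policy m p}
    (h1 : ∀ w i, i + 1 < S.N → θ'.input w i = θ.input (cons 0 w) (i + 1))
    (h2 : ∀ w i, i + 1 = S.N → θ'.input w i = act S.K (S.state x θ (cons 0 w) (i + 1))) :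
    S.excess (act S.A x + act S.B (θ.v 0)) θ' + quad S.H (θ.v 0 - act S.K x) ≤
      S.excess x θ := by
  obtain ⟨M, hM⟩ := Nat.exists_eq_succ_of_ne_zero h.horizon_pos.ne'
  have hst : ∀ w i, i < S.N → S.state (act S.A x + act S.B (θ.v 0)) θ' w i =
      S.state x θ (cons 0 w) (i + 1) := fun w i hi => by
    rw [← state_shift h1 w i hi, act_zero, add_zero]
  have hdev : ∀ i < M, S.deviation (act S.A x + act S.B (θ.v 0)) θ' i =
      fun w => S.deviation x θ (i + 1) (cons 0 w) := fun i hi => by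
    funext w
    rw [deviation, hst w i (by omega), h1 w i (by omega)]
    rfl
  have hlast : S.deviation (act S.A x + act S.B (θ.v 0)) θ' M = fun _ => 0 := by
    funext w
    rw [deviation, hst w M (by omega), h2 w M (by omega), sub_self]
  simp only [excess, hM]
  rw [Finset.sum_range_succ, Finset.sum_range_succ', hlast]
  simp only [deviation_zero, quad_zero, integral_const, smul_zero, add_zero, probReal_univ,
    one_smul]
  refine add_le_add_left (Finset.sum_le_sum fun i hi => ?_) _
  rw [hdev i (Finset.mem_range.mp hi)]
  exact (isCausalAffine_deviation x θ (i + 1)).integral_quad_cons_zero_le h.isBoundedCentered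
    h.posDef_H.posSemidef

/-- The policy of the terminal feedback `u = K x`. -/
lemma IsAdmissible.exists_feedback (h : S.IsAdmissible) {x : Vec n} (hx : x ∈ S.Xf) :
    ∃ θ : Policy m p, S.Feasible x θ ∧ S.excess x θ = 0 := by
  let ξ : (ℕ → Vec p) → ℕ → Vec n := fun w i =>
    Nat.rec x (fun i z => act S.A z + act S.B (act S.K z) + act S.D (w i)) i
  have hξs : ∀ w i, ξ w (i + 1) = act S.A (ξ w i) + act S.B (act S.K (ξ w i)) + act S.D (w i) :=
    fun w i => rfl
  have hξ : ∀ i, IsCausalAffine i fun w => ξ w i := by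
    intro i
    induction i with
    | zero => exact IsCausalAffine.const 0 x
    | succ i ih =>
      exact (((ih.act S.A).add ((ih.act S.K).act S.B)).mono i.le_succ).add
        (IsCausalAffine.act_coord i S.D)
  obtain ⟨θ, hθ⟩ := exists_policy_input_eq (fun i w => act S.K (ξ w i)) fun i => (hξ i).act S.K
  have hst : ∀ w i, S.state x θ w i = ξ w i := by
    intro w i
    induction i with
    | zero => rfl
    | succ i ih => rw [state, ih, hθ, hξs]
  refine ⟨θ, fun w hw => ?_, ?_⟩
  · have hmem : ∀ i, S.state x θ w i ∈ S.Xf := by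
      intro i
      rw [hst]
      induction i with
      | zero => exact hx
      | succ i ih => exact h.invariant_Xf _ ih _ (hw i)
    refine ⟨fun i _ => ?_, hmem S.N⟩
    rw [hθ, ← hst]
    exact h.constraint_Xf _ (hmem i)
  · refine Finset.sum_eq_zero fun i _ => ?_
    simp [deviation, hst, hθ]

lemma IsAdmissible.Xf_subset (h : S.IsAdmissible) : S.Xf ⊆ S.feasibleSet := fun _ hx =>
  (h.exists_feedback hx).imp fun _ hθ => hθ.1

/-- On the terminal set every optimal policy starts with the terminal feedback. -/
lemma IsAdmissible.optimal_eq_feedback (h : S.IsAdmissible) {x : Vec n} (hx : x ∈ S.Xf)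
    {θ : Policy m p} (hθ : S.IsOptimal x θ) : θ.v 0 = act S.K x := by
  obtain ⟨θ', hθ', h0⟩ := h.exists_feedback hx
  have h1 : S.excess x θ ≤ 0 := h0 ▸ h.excess_le_of_isOptimal hθ hθ'
  have h2 : quad S.H (θ.v 0 - act S.K x) ≤ S.excess x θ := by
    have := Finset.single_le_sum (f := fun i => ∫ w, quad S.H (S.deviation x θ i w)
      ∂(seqLaw (S.μ : Measure (Vec p)))) (fun _ _ => integral_nonneg fun _ =>
        quad_nonneg h.posDef_H.posSemidef _) (Finset.mem_range.mpr h.horizon_pos)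
    simpa [deviation_zero, excess] using this
  exact sub_eq_zero.mp (quad_eq_zero h.posDef_H
    (le_antisymm (h2.trans h1) (quad_nonneg h.posDef_H.posSemidef _)))

end Problem

end Cost

/-! ### The terminal set and the feasible set -/

section Sets

variable {n m p : ℕ} {S : Problem n m p}

/-- The policy `θ` with the variables that do not enter a problem of horizon `N` set to zero. -/
def truncate (N : ℕ) (θ : Policy m p) : Policy m p where
  v i := if i < N then θ.v i else 0
  M i j := if j < i ∧ i < N then θ.M i j else 0

lemma truncate_input {N : ℕ} (θ : Policy m p) (w : ℕ → Vec p) {i : ℕ} (hi : i < N) :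
    (truncate N θ).input w i = θ.input w i := by
  simp only [Policy.input, truncate, hi, if_true, and_true]
  congr 1
  exact Finset.sum_congr rfl fun j hj => by rw [if_pos (Finset.mem_range.mp hj)]

lemma truncate_state {N : ℕ} (x : Vec n) (θ : Policy m p) (w : ℕ → Vec p) {i : ℕ} (hi : i ≤ N) :
    S.state x (truncate N θ) w i = S.state x θ w i := by
  induction i with
  | zero => rfl
  | succ i ih => rw [Problem.state, ih (by omega), truncate_input θ w (by omega)]; rfl

lemma feasible_truncate {x : Vec n} {θ : Policy m p} (hθ : S.Feasible x θ) :
    S.Feasible x (truncate S.N θ) := by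
  intro w hw
  obtain ⟨h1, h2⟩ := hθ w hw
  refine ⟨fun i hi => ?_, ?_⟩
  · rw [truncate_state x θ w hi.le, truncate_input θ w hi]
    exact h1 i hi
  · rwa [truncate_state x θ w le_rfl]

lemma continuous_input (w : ℕ → Vec p) (i : ℕ) :
    Continuous fun q : Vec n × (ℕ → Vec m) × (ℕ → ℕ → Matrix (Fin m) (Fin p) ℝ) =>
      (⟨q.2.1, q.2.2⟩ : Policy m p).input w i := by
  unfold Policy.input
  refine Continuous.add (by fun_prop) (continuous_finsetSum _ fun j _ => ?_)
  exact continuous_act_act.comp (Continuous.prodMk (by fun_prop) continuous_const)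

lemma continuous_state (S : Problem n m p) (w : ℕ → Vec p) (i : ℕ) :
    Continuous fun q : Vec n × (ℕ → Vec m) × (ℕ → ℕ → Matrix (Fin m) (Fin p) ℝ) =>
      S.state q.1 ⟨q.2.1, q.2.2⟩ w i := by
  induction i with
  | zero => exact continuous_fst
  | succ i ih =>
    exact (((continuous_act S.A).comp ih).add ((continuous_act S.B).comp
      (continuous_input w i))).add continuous_const

namespace Problem.IsAdmissible

lemma zero_mem (h : S.IsAdmissible) : (0 : Vec p) ∈ S.W := interior_subset h.zero_mem_W

lemma act_Acl_mem (h : S.IsAdmissible) {x : Vec n} (hx : x ∈ S.Xf) : act S.Acl x ∈ S.Xf := by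
  have := h.invariant_Xf x hx 0 h.zero_mem
  rwa [act_zero, add_zero, ← Problem.act_Acl] at this

lemma zero_mem_Xf (h : S.IsAdmissible) : (0 : Vec n) ∈ S.Xf := by
  obtain ⟨x, hx⟩ := h.nonempty_Xf
  refine h.isClosed_Xf.mem_of_tendsto (h.schur.tendsto_iterate x) (Eventually.of_forall fun k => ?_)
  induction k with
  | zero => exact hx
  | succ k ih => rw [Function.iterate_succ_apply']; exact h.act_Acl_mem ih

/-- The terminal set contains the states reachable from the origin. -/
lemma reachable_mem_Xf (h : S.IsAdmissible) (j : ℕ) (y : ℕ → Vec p) (hy : ∀ k, y k ∈ S.W) :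
    ∑ k ∈ Finset.range j, act (S.Acl ^ k * S.D) (y k) ∈ S.Xf := by
  induction j generalizing y with
  | zero => simpa using h.zero_mem_Xf
  | succ j ih =>
    have := h.invariant_Xf _ (ih (fun k => y (k + 1)) fun k => hy (k + 1)) (y 0) (hy 0)
    rw [← Problem.act_Acl, act_sum] at this
    rw [Finset.sum_range_succ']
    simpa only [pow_succ', Matrix.mul_assoc, mul_act, pow_zero, one_act] using this

/-- By controllability the states reachable from the origin in `n` steps fill a neighbourhood. -/
lemma zero_mem_interior_Xf (h : S.IsAdmissible) : (0 : Vec n) ∈ interior S.Xf := by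
  let Λ : (Fin n → Vec p) →ₗ[ℝ] Vec n :=
    ∑ k : Fin n, (Matrix.toEuclideanLin (S.Acl ^ (k : ℕ) * S.D)) ∘ₗ LinearMap.proj k
  have hΛ : ∀ y, Λ y = ∑ k : Fin n, act (S.Acl ^ (k : ℕ) * S.D) (y k) := fun y => by
    simp only [Λ, LinearMap.sum_apply]
    rfl
  have hsurj : Function.Surjective Λ := by
    intro z
    have hrange : LinearMap.range (controllabilityMatrix S.Acl S.D).mulVecLin = ⊤ := by
      apply Submodule.eq_top_of_finrank_eq
      rw [Module.finrank_fin_fun]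
      exact h.controllable
    obtain ⟨v, hv⟩ := LinearMap.range_eq_top.mp hrange z.ofLp
    refine ⟨fun k => WithLp.toLp 2 fun l => v (k, l), ?_⟩
    ext i
    have hvi := congrFun hv i
    rw [hΛ, ← hvi]
    simp [act_apply, controllabilityMatrix, Matrix.mulVec, dotProduct, Fintype.sum_prod_type]
  have hopen : IsOpen (Λ '' Set.univ.pi fun _ => interior S.W) :=
    Λ.isOpenMap_of_finiteDimensional hsurj _
      (isOpen_set_pi Set.finite_univ fun _ _ => isOpen_interior)
  refine mem_interior.mpr ⟨_, ?_, hopen, 0, fun _ _ => h.zero_mem_W, map_zero Λ⟩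
  rintro _ ⟨y, hy, rfl⟩
  rw [hΛ]
  have := h.reachable_mem_Xf n (fun k => if hk : k < n then y ⟨k, hk⟩ else 0) fun k => by
    by_cases hk : k < n
    · simpa only [hk, dif_pos] using interior_subset (hy ⟨k, hk⟩ trivial)
    · simpa only [hk, dif_neg, not_false_eq_true] using h.zero_mem
  rw [Finset.sum_range] at this
  simpa using this

lemma exists_bound_Z (h : S.IsAdmissible) :
    ∃ ρ : ℝ, ∀ z ∈ S.Z, ‖z.1‖ ≤ ρ ∧ ‖z.2‖ ≤ ρ := by
  obtain ⟨ρ, hρ⟩ := h.isCompact_Z.isBounded.exists_norm_le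
  exact ⟨ρ, fun z hz => ⟨(norm_fst_le z).trans (hρ z hz), (norm_snd_le z).trans (hρ z hz)⟩⟩

lemma isBounded_Xf (h : S.IsAdmissible) : Bornology.IsBounded S.Xf := by
  obtain ⟨ρ, hρ⟩ := h.exists_bound_Z
  exact isBounded_iff_forall_norm_le.mpr ⟨ρ, fun x hx => (hρ _ (h.constraint_Xf x hx)).1⟩

lemma isCompact_Xf (h : S.IsAdmissible) : IsCompact S.Xf :=
  Metric.isCompact_of_isClosed_isBounded h.isClosed_Xf h.isBounded_Xf

/-- The feasible set is a projection of a compact set of pairs of states and policies: the open-loop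
inputs are bounded because the disturbance may vanish, and the gains because single disturbances
range over a ball. -/
lemma isCompact_feasibleSet (h : S.IsAdmissible) : IsCompact S.feasibleSet := by
  obtain ⟨ρ, hρ⟩ := h.exists_bound_Z
  obtain ⟨δ, hδ, hδW⟩ := Metric.mem_nhds_iff.mp (mem_interior_iff_mem_nhds.mp h.zero_mem_W)
  let b : ℝ := 2 * ρ / (δ / 2)
  let box : Set (Vec n × (ℕ → Vec m) × (ℕ → ℕ → Matrix (Fin m) (Fin p) ℝ)) :=
    Metric.closedBall 0 ρ ×ˢ (Set.univ.pi fun _ => Metric.closedBall 0 ρ) ×ˢ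
      (Set.univ.pi fun _ => Set.univ.pi fun _ =>
        (Set.univ.pi fun _ => Set.univ.pi fun _ => Set.Icc (-b) b :
          Set (Fin m → Fin p → ℝ)))
  have hbox : IsCompact box :=
    (isCompact_closedBall _ _).prod ((isCompact_univ_pi fun _ => isCompact_closedBall _ _).prod
      (isCompact_univ_pi fun _ => isCompact_univ_pi fun _ =>
        (isCompact_univ_pi fun _ => isCompact_univ_pi fun _ => isCompact_Icc :
          IsCompact (Set.univ.pi fun _ => Set.univ.pi fun _ => Set.Icc (-b) b :
            Set (Fin m → Fin p → ℝ)))))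
  have hclosed : IsClosed {q : Vec n × (ℕ → Vec m) × (ℕ → ℕ → Matrix (Fin m) (Fin p) ℝ) |
      S.Feasible q.1 ⟨q.2.1, q.2.2⟩} := by
    simp only [Problem.Feasible, Set.ofPred_forall, Set.ofPred_and]
    refine isClosed_iInter fun w => isClosed_iInter fun _ => IsClosed.inter ?_ ?_
    · exact isClosed_iInter fun i => isClosed_iInter fun _ => h.isCompact_Z.isClosed.preimage
        ((continuous_state S w i).prodMk (continuous_input w i))
    · exact h.isClosed_Xf.preimage (continuous_state S w S.N)
  convert (hbox.inter_right hclosed).image continuous_fst using 1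
  ext x
  constructor
  · rintro ⟨θ, hθ⟩
    have h0 := (hθ (fun _ => 0) fun _ => h.zero_mem).1
    have hx : ‖x‖ ≤ ρ := (hρ _ (h0 0 h.horizon_pos)).1
    have hρ0 : 0 ≤ ρ := (norm_nonneg x).trans hx
    have hv : ∀ i < S.N, ‖θ.v i‖ ≤ ρ := fun i hi => by
      simpa [Policy.input] using (hρ _ (h0 i hi)).2
    have hM : ∀ i < S.N, ∀ j < i, ∀ k l, |θ.M i j k l| ≤ b := by
      intro i hi j hj k l
      -- the response to a single disturbance of size `δ / 2` in the `l`-th direction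
      let y : Vec p := EuclideanSpace.single l (δ / 2)
      have hy : y ∈ S.W := hδW (by simp [y, abs_of_pos hδ, hδ])
      have h1 := (hθ (Function.update (fun _ => 0) j y) fun j' => by
        rcases eq_or_ne j' j with rfl | hne
        · simpa using hy
        · simpa [hne] using h.zero_mem).1 i hi
      have h2 : θ.input (Function.update (fun _ => 0) j y) i = θ.v i + act (θ.M i j) y := by
        rw [Policy.input, Finset.sum_eq_single j]
        · simp
        · intro j' _ hne
          simp [hne]
        · intro hj'
          exact absurd (Finset.mem_range.mpr hj) hj'
      have h3 : ‖act (θ.M i j) y‖ ≤ 2 * ρ := by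
        have h4 := (hρ _ h1).2
        simp only [h2] at h4
        have h5 := norm_sub_le (θ.v i + act (θ.M i j) y) (θ.v i)
        rw [add_sub_cancel_left] at h5
        linarith [hv i hi]
      have h6 : act (θ.M i j) y k = θ.M i j k l * (δ / 2) := by
        simp [act_apply, y]
      have h7 := (PiLp.norm_apply_le (act (θ.M i j) y) k).trans h3
      rw [h6, Real.norm_eq_abs, abs_mul, abs_of_pos (half_pos hδ)] at h7
      exact (le_div_iff₀ (half_pos hδ)).mpr h7
    have hb : 0 ≤ b := by positivity
    refine ⟨(x, (truncate S.N θ).v, (truncate S.N θ).M), ⟨⟨?_, ?_, ?_⟩, feasible_truncate hθ⟩, rfl⟩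
    · simpa using hx
    · intro i _
      by_cases hi : i < S.N
      · simpa [truncate, hi] using hv i hi
      · simpa [truncate, hi] using hρ0
    · intro i _ j _ k _ l _
      rw [Set.mem_Icc, ← abs_le]
      by_cases hij : j < i ∧ i < S.N
      · simpa [truncate, hij] using hM i hij.2 j hij.1 k l
      · simpa [truncate, hij] using hb
  · rintro ⟨q, ⟨_, hq⟩, rfl⟩
    exact ⟨_, hq⟩

/-- The costs of feasible policies are bounded. -/
lemma exists_cost_le (h : S.IsAdmissible) : ∃ C, ∀ x θ, S.Feasible x θ → S.cost x θ ≤ C := by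
  obtain ⟨C₁, hC₁⟩ := h.isCompact_Z.exists_bound_of_continuousOn
    (f := fun z : Vec n × Vec m => quad S.Q z.1 + quad S.R z.2) (by fun_prop)
  obtain ⟨C₂, hC₂⟩ := h.isCompact_Xf.exists_bound_of_continuousOn
    (f := quad S.P) (by fun_prop)
  refine ⟨C₂ + S.N * C₁, fun x θ hθ => ?_⟩
  have hpath : ∀ᵐ w ∂(seqLaw (S.μ : Measure (Vec p))), ‖S.pathCost x θ w‖ ≤ C₂ + S.N * C₁ := by
    filter_upwards [ae_seqLaw h.ae_mem_W] with w hw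
    obtain ⟨h1, h2⟩ := hθ w hw
    refine (norm_add_le _ _).trans (add_le_add (hC₂ _ h2) ((norm_sum_le _ _).trans ?_))
    refine (Finset.sum_le_card_nsmul _ _ C₁ fun i hi =>
      hC₁ _ (h1 i (Finset.mem_range.mp hi))).trans ?_
    simp
  have := norm_integral_le_of_norm_le_const hpath
  rw [probReal_univ, mul_one] at this
  exact (le_abs_self _).trans this

end Problem.IsAdmissible

end Sets

/-! ### Comparison functions -/

section Comparison

lemma isClassKInf_const_mul_sq {c : ℝ≥0} (hc : 0 < c) : IsClassKInf fun s => c * s ^ 2 where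
  continuous := by fun_prop
  strictMono := fun s t hst =>
    mul_lt_mul_of_pos_left (pow_lt_pow_left₀ hst zero_le two_ne_zero) hc
  map_zero := by simp
  tendsto_atTop := (tendsto_pow_atTop two_ne_zero).const_mul_atTop hc

/-- A bounded family that is small wherever the parameter `r` is small lies below a function of
class `𝒦` of `r`. If `f ≤ 2⁻ⁿ` for `r < δₙ`, the `n`-th summand of this function accounts for the
range `δₙ ≤ r < δₙ₋₁`; for `r ≥ δ₀` the bound `B` is used. -/
lemma exists_isClassK_le {ι : Type*} (f : ι → ℝ) (r : ι → ℝ≥0) (B : ℝ) (hB : ∀ i, f i ≤ B)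
    (h : ∀ ε : ℝ, 0 < ε → ∃ δ : ℝ, 0 < δ ∧ ∀ i, (r i : ℝ) < δ → f i ≤ ε) :
    ∃ σ : ℝ≥0 → ℝ≥0, IsClassK σ ∧ ∀ i, f i ≤ σ (r i) := by
  choose δ hδ hfδ using fun n : ℕ => h ((1 / 2) ^ n) (by positivity)
  let φ : ℕ → ℝ≥0 → ℝ := fun n s => min 1 ((s : ℝ) / δ n)
  have hφ0 : ∀ n s, 0 ≤ φ n s := fun n s =>
    le_min zero_le_one (div_nonneg s.coe_nonneg (hδ n).le)
  have hφ1 : ∀ n s, φ n s ≤ 1 := fun n s => min_le_left _ _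
  have hφm : ∀ n, Monotone (φ n) := fun n s t hst =>
    min_le_min_left _ (div_le_div_of_nonneg_right (by exact_mod_cast hst) (hδ n).le)
  have hφe : ∀ n (s : ℝ≥0), δ n ≤ (s : ℝ) → φ n s = 1 := fun n s hs =>
    min_eq_left ((one_le_div₀ (hδ n)).mpr hs)
  have hφc : ∀ n, Continuous (φ n) := fun n => by fun_prop
  have hgeo : Summable fun n : ℕ => 2 * (1 / 2 : ℝ) ^ n :=
    (summable_geometric_of_lt_one (by norm_num) (by norm_num)).mul_left 2
  have hle : ∀ n s, 2 * (1 / 2 : ℝ) ^ n * φ n s ≤ 2 * (1 / 2 : ℝ) ^ n := fun n s =>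
    mul_le_of_le_one_right (by positivity) (hφ1 n s)
  have hnn : ∀ n s, 0 ≤ 2 * (1 / 2 : ℝ) ^ n * φ n s := fun n s =>
    mul_nonneg (by positivity) (hφ0 n s)
  have hsum : ∀ s, Summable fun n : ℕ => 2 * (1 / 2 : ℝ) ^ n * φ n s := fun s =>
    Summable.of_nonneg_of_le (fun n => hnn n s) (fun n => hle n s) hgeo
  let τ : ℝ≥0 → ℝ := fun s => s + (max B 0 * φ 0 s + ∑' n : ℕ, 2 * (1 / 2 : ℝ) ^ n * φ n s)
  have hτc : Continuous τ := by
    refine NNReal.continuous_coe.add ((continuous_const.mul (hφc 0)).add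
      (continuous_tsum (fun n => continuous_const.mul (hφc n)) hgeo fun n s => ?_))
    rw [Real.norm_of_nonneg (hnn n s)]
    exact hle n s
  have hτm : StrictMono τ := fun s t hst =>
    add_lt_add_of_lt_of_le (by exact_mod_cast hst) (add_le_add
      (mul_le_mul_of_nonneg_left (hφm 0 hst.le) (le_max_right _ _))
      ((hsum s).tsum_le_tsum (fun n => mul_le_mul_of_nonneg_left (hφm n hst.le) (by positivity))
        (hsum t)))
  have hτ0 : τ 0 = 0 := by simp [τ, φ]
  have hτn : ∀ s, 0 ≤ τ s := fun s => hτ0 ▸ hτm.monotone zero_le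
  refine ⟨fun s => (τ s).toNNReal, ⟨continuous_real_toNNReal.comp hτc, fun s t hst => ?_,
    by simp [hτ0]⟩,
    fun i => ?_⟩
  · exact (Real.toNNReal_lt_toNNReal_iff ((hτn s).trans_lt (hτm hst))).mpr (hτm hst)
  rw [Real.coe_toNNReal _ (hτn _)]
  have htsum : 0 ≤ ∑' n : ℕ, 2 * (1 / 2 : ℝ) ^ n * φ n (r i) := tsum_nonneg fun n => hnn n _
  have hr : 0 ≤ (r i : ℝ) := (r i).coe_nonneg
  have hBφ : 0 ≤ max B 0 * φ 0 (r i) := mul_nonneg (le_max_right _ _) (hφ0 _ _)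
  by_cases hex : ∃ n, δ n ≤ (r i : ℝ)
  · classical
    have hn := Nat.find_spec hex
    rcases hcase : Nat.find hex with _ | k
    · rw [hcase] at hn
      have : f i ≤ max B 0 * φ 0 (r i) := by
        rw [hφe 0 _ hn, mul_one]
        exact (hB i).trans (le_max_left _ _)
      simp only [τ]
      linarith
    · rw [hcase] at hn
      have hk : (r i : ℝ) < δ k := not_le.mp (Nat.find_min hex (by omega))
      have h1 := (hsum (r i)).le_tsum (k + 1) fun n _ => hnn n _
      rw [hφe _ _ hn, mul_one, pow_succ] at h1
      have h2 := hfδ k i hk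
      simp only [τ]
      linarith
  · push Not at hex
    have h0 : f i ≤ 0 := ge_of_tendsto'
      (tendsto_pow_atTop_nhds_zero_of_lt_one (by norm_num : (0 : ℝ) ≤ 1 / 2) (by norm_num))
      fun n => hfδ n i (hex n)
    exact h0.trans (hτn _)

end Comparison

/-! ### A continuous Lyapunov function for the undisturbed closed loop -/

section Converse

variable {n : ℕ}

/-- A continuous map of a compact set `X` that is linear and Schur stable on an invariant
neighbourhood `Xf` of the origin, and decreases some bounded function by at least `γ ‖x‖²`, has a
continuous quadratically bounded Lyapunov function. The decrease drives every trajectory into `Xf`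
within a common time `T`, and the function is the sum of `‖gᵏ x‖²` over `k < T` plus a multiple of
the square of an adapted norm at time `T`. -/
lemma exists_continuous_lyapunov {X Xf : Set (Vec n)} {g : Vec n → Vec n}
    {Acl : Matrix (Fin n) (Fin n) ℝ} (hX : IsCompact X) (hgX : Set.MapsTo g X X)
    (hgc : ContinuousOn g X) (h0 : (0 : Vec n) ∈ interior Xf)
    (hgXf : Set.MapsTo g Xf Xf) (hlin : ∀ x ∈ Xf, g x = act Acl x) (hAcl : IsSchurStable Acl)
    {U : Vec n → ℝ} {Umax γ : ℝ} (hγ : 0 < γ) (hU0 : ∀ x ∈ X, 0 ≤ U x)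
    (hU1 : ∀ x ∈ X, U x ≤ Umax) (hU : ∀ x ∈ X, U (g x) ≤ U x - γ * ‖x‖ ^ 2) :
    ∃ (V : Vec n → ℝ) (C : ℝ), 0 < C ∧ ContinuousOn V X ∧
      (∀ x ∈ X, ‖x‖ ^ 2 ≤ V x) ∧ (∀ x ∈ X, V x ≤ C * ‖x‖ ^ 2) ∧
      ∀ x ∈ X, V (g x) ≤ V x - ‖x‖ ^ 2 := by
  obtain ⟨q, c, Cq, hq⟩ := hAcl.exists_adaptedNorm
  obtain ⟨r, hr, hrXf⟩ := Metric.mem_nhds_iff.mp (mem_interior_iff_mem_nhds.mp h0)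
  obtain ⟨k₀, hk₀⟩ := exists_nat_gt (Umax / (γ * r ^ 2))
  have hiter : ∀ k, Set.MapsTo g^[k] X X := fun k => hgX.iterate k
  have hiterf : ∀ k, Set.MapsTo g^[k] Xf Xf := fun k => hgXf.iterate k
  have hpot : ∀ x ∈ X, ∀ k, U (g^[k] x) + ∑ j ∈ Finset.range k, γ * ‖g^[j] x‖ ^ 2 ≤ U x := by
    intro x hx k
    induction k with
    | zero => simp
    | succ k ih =>
      rw [Finset.sum_range_succ, Function.iterate_succ_apply']
      linarith [hU _ (hiter k hx)]
  -- within `T` steps a trajectory that stays outside the ball of radius `r` would use up `Umax`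
  set T := k₀ + 1 with hT
  have hreach : ∀ x ∈ X, g^[T] x ∈ Xf := by
    intro x hx
    have hex : ∃ k < T, ‖g^[k] x‖ < r := by
      by_contra! hcon
      have h1 : ∑ j ∈ Finset.range T, γ * r ^ 2 ≤ ∑ j ∈ Finset.range T, γ * ‖g^[j] x‖ ^ 2 :=
        Finset.sum_le_sum fun j hj => mul_le_mul_of_nonneg_left
          (pow_le_pow_left₀ hr.le (hcon j (Finset.mem_range.mp hj)) 2) hγ.le
      rw [Finset.sum_const, Finset.card_range, nsmul_eq_mul] at h1
      have h2 := hpot x hx T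
      have h3 := hU0 _ (hiter T hx)
      have h4 := hU1 x hx
      rw [div_lt_iff₀ (by positivity)] at hk₀
      have h5 : (T : ℝ) * (γ * r ^ 2) = k₀ * (γ * r ^ 2) + γ * r ^ 2 := by
        rw [hT]; push_cast; ring
      have h6 : 0 < γ * r ^ 2 := by positivity
      linarith
    obtain ⟨k, hk, hkr⟩ := hex
    have h1 : g^[k] x ∈ Xf := hrXf (by simpa using hkr)
    have h2 := hiterf (T - k) h1
    rwa [← Function.iterate_add_apply, Nat.sub_add_cancel hk.le] at h2
  have hc1 : 0 < 1 - c := sub_pos.mpr hq.c_lt_one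
  have hcont : ∀ k, ContinuousOn g^[k] X := fun k => hgc.iterate hgX k
  let V : Vec n → ℝ := fun x =>
    ∑ k ∈ Finset.range T, ‖g^[k] x‖ ^ 2 + 1 / (1 - c) * q (g^[T] x) ^ 2
  have hVc : ContinuousOn V X :=
    (continuousOn_finsetSum _ fun k _ => (hcont k).norm.pow 2).add
      (continuousOn_const.mul ((hq.continuous.comp_continuousOn (hcont T)).pow 2))
  have hVlow : ∀ x, ‖x‖ ^ 2 ≤ V x := by
    intro x
    have h1 := Finset.single_le_sum (f := fun k => ‖g^[k] x‖ ^ 2) (fun k _ => by positivity)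
      (Finset.mem_range.mpr (Nat.succ_pos k₀))
    have h2 : 0 ≤ 1 / (1 - c) * q (g^[T] x) ^ 2 := by positivity
    simp only [Function.iterate_zero, id_eq] at h1
    simp only [V]
    linarith
  obtain ⟨Vmax, hVmax⟩ := hX.exists_bound_of_continuousOn hVc
  refine ⟨V, (T + 1 / (1 - c)) * Cq ^ 2 + |Vmax| / r ^ 2, ?_, hVc, fun x _ => hVlow x, ?_, ?_⟩
  · have := hq.C_pos
    positivity
  · intro x hx
    by_cases hxf : x ∈ Xf
    · have hqk : ∀ k, q (g^[k] x) ≤ Cq * ‖x‖ := by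
        intro k
        have : q (g^[k] x) ≤ q x := by
          induction k with
          | zero => rfl
          | succ k ih =>
            rw [Function.iterate_succ_apply', hlin _ (hiterf k hxf)]
            refine (hq.contract _).trans (le_trans ?_ ih)
            exact mul_le_of_le_one_left (hq.nonneg _) hq.c_lt_one.le
        exact this.trans (hq.le_norm x)
      have hsq : ∀ k, q (g^[k] x) ^ 2 ≤ Cq ^ 2 * ‖x‖ ^ 2 := fun k => by
        rw [← mul_pow]
        exact pow_le_pow_left₀ (hq.nonneg _) (hqk k) 2
      have h1 : ∑ k ∈ Finset.range T, ‖g^[k] x‖ ^ 2 ≤ T * (Cq ^ 2 * ‖x‖ ^ 2) := by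
        refine (Finset.sum_le_card_nsmul _ _ (Cq ^ 2 * ‖x‖ ^ 2) fun k _ => ?_).trans (by simp)
        exact (pow_le_pow_left₀ (norm_nonneg _) (hq.norm_le _) 2).trans (hsq k)
      have h2 : 1 / (1 - c) * q (g^[T] x) ^ 2 ≤ 1 / (1 - c) * (Cq ^ 2 * ‖x‖ ^ 2) :=
        mul_le_mul_of_nonneg_left (hsq T) (by positivity)
      have h3 : 0 ≤ |Vmax| / r ^ 2 * ‖x‖ ^ 2 := by positivity
      simp only [V]
      linarith
    · have hrx : r ≤ ‖x‖ := by
        by_contra! hlt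
        exact hxf (hrXf (by simpa using hlt))
      have h1 : V x ≤ |Vmax| := (le_abs_self _).trans ((hVmax x hx).trans (le_abs_self _))
      have h2 : |Vmax| ≤ |Vmax| / r ^ 2 * ‖x‖ ^ 2 := by
        rw [div_mul_eq_mul_div, le_div_iff₀ (by positivity)]
        exact mul_le_mul_of_nonneg_left (pow_le_pow_left₀ hr.le hrx 2) (abs_nonneg _)
      have h3 : 0 ≤ (T + 1 / (1 - c)) * Cq ^ 2 * ‖x‖ ^ 2 := by positivity
      linarith
  · intro x hx
    have h1 : V (g x) + ‖x‖ ^ 2 = ∑ k ∈ Finset.range T, ‖g^[k] x‖ ^ 2 + ‖g^[T] x‖ ^ 2 +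
        1 / (1 - c) * q (g (g^[T] x)) ^ 2 := by
      rw [← Finset.sum_range_succ (fun k => ‖g^[k] x‖ ^ 2), Finset.sum_range_succ']
      simp only [V, ← Function.iterate_succ_apply, ← Function.iterate_succ_apply' g,
        Function.iterate_zero, id_eq]
      ring
    have h2 : q (g (g^[T] x)) ^ 2 ≤ c * q (g^[T] x) ^ 2 := by
      rw [hlin _ (hreach x hx)]
      have := hq.sq_add_le (g^[T] x) 0
      simpa using this
    have h3 : 1 / (1 - c) * q (g (g^[T] x)) ^ 2 ≤ 1 / (1 - c) * q (g^[T] x) ^ 2 -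
        q (g^[T] x) ^ 2 := by
      have h4 := mul_le_mul_of_nonneg_left h2 (show 0 ≤ 1 / (1 - c) by positivity)
      refine h4.trans (le_of_eq ?_)
      field_simp
      ring
    have h5 : ‖g^[T] x‖ ^ 2 ≤ q (g^[T] x) ^ 2 :=
      pow_le_pow_left₀ (norm_nonneg _) (hq.norm_le _) 2
    simp only [V] at h1 ⊢
    linarith

/-- A quadratically bounded Lyapunov function of the undisturbed system that is continuous on a
compact state space is an ISS-Lyapunov function: uniform continuity bounds the effect of the
disturbance. -/
lemma isISSLyapunov_of_isCompact {p : ℕ} {X : Set (Vec n)} {W : Set (Vec p)} {g : Vec n → Vec n}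
    {D : Matrix (Fin n) (Fin p) ℝ} (hX : IsCompact X) (hgX : Set.MapsTo g X X)
    (hinv : IsRobustlyInvariant (nextState g D) W X) {V : Vec n → ℝ} {C : ℝ} (hC : 0 < C)
    (hVc : ContinuousOn V X) (hV1 : ∀ x ∈ X, ‖x‖ ^ 2 ≤ V x) (hV2 : ∀ x ∈ X, V x ≤ C * ‖x‖ ^ 2)
    (hV : ∀ x ∈ X, V (g x) ≤ V x - ‖x‖ ^ 2) : IsISSLyapunov X W (nextState g D) V := by
  have hV0 : ∀ x ∈ X, 0 ≤ V x := fun x hx => (sq_nonneg _).trans (hV1 x hx)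
  obtain ⟨B, hB⟩ := hX.exists_bound_of_continuousOn hVc
  obtain ⟨d, hd, hdb⟩ := exists_norm_act_le D
  have hunif := Metric.uniformContinuousOn_iff.mp (hX.uniformContinuousOn_of_continuous hVc)
  obtain ⟨σ, hσ, hσb⟩ := exists_isClassK_le
    (fun i : X × W => V (nextState g D i.1 i.2) - V (g i.1)) (fun i => ‖(i.2 : Vec p)‖₊) B
    (fun i => by
      have h1 := (le_abs_self _).trans (hB _ (hinv i.1 i.1.2 i.2 i.2.2))
      have h2 := hV0 _ (hgX i.1.2)
      linarith)
    (fun ε hε => by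
      obtain ⟨δ, hδ, h⟩ := hunif ε hε
      refine ⟨δ / d, by positivity, fun i hi => ?_⟩
      rw [coe_nnnorm, lt_div_iff₀ hd] at hi
      have h1 := h _ (hinv i.1 i.1.2 i.2 i.2.2) _ (hgX i.1.2) (by
        rw [nextState, dist_eq_norm, add_sub_cancel_left]
        linarith [hdb (i.2 : Vec p)])
      rw [Real.dist_eq] at h1
      exact (le_abs_self _).trans h1.le)
  refine ⟨hVc, hV0, fun s => 1 * s ^ 2, fun s => C.toNNReal * s ^ 2, fun s => 1 * s ^ 2, σ,
    isClassKInf_const_mul_sq one_pos, isClassKInf_const_mul_sq (Real.toNNReal_pos.mpr hC),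
    isClassKInf_const_mul_sq one_pos, hσ, fun x hx => ⟨?_, ?_⟩, fun x hx w hw => ?_⟩
  · simpa using hV1 x hx
  · simpa [hC.le] using hV2 x hx
  · have h1 := hσb (⟨x, hx⟩, ⟨w, hw⟩)
    have h2 := hV x hx
    simp only [one_mul, NNReal.coe_pow, coe_nnnorm] at h1 ⊢
    linarith

end Converse

/-! ### The closed loop -/

section ClosedLoop

variable {n m p : ℕ} {S : Problem n m p} {θs : Vec n → Policy m p}

namespace Problem.IsAdmissible

lemma isRobustlyInvariant (h : S.IsAdmissible) (hθs : ∀ x ∈ S.feasibleSet, S.IsOptimal x (θs x)) :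
    IsRobustlyInvariant (nextState (S.drift θs) S.D) S.W S.feasibleSet := by
  intro x hx y hy
  obtain ⟨θ', h1, h2⟩ := exists_shift S x (θs x) y
  exact ⟨θ', h.feasible_shift (hθs x hx).1 hy h1 h2⟩

lemma mapsTo_drift (h : S.IsAdmissible) (hθs : ∀ x ∈ S.feasibleSet, S.IsOptimal x (θs x)) :
    Set.MapsTo (S.drift θs) S.feasibleSet S.feasibleSet := by
  intro x hx
  have := h.isRobustlyInvariant hθs x hx 0 h.zero_mem
  rwa [nextState, act_zero, add_zero] at this

lemma drift_eq (h : S.IsAdmissible) (hθs : ∀ x ∈ S.feasibleSet, S.IsOptimal x (θs x)) {x : Vec n}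
    (hx : x ∈ S.Xf) : S.drift θs x = act S.Acl x := by
  rw [drift, h.optimal_eq_feedback hx (hθs x (h.Xf_subset hx)), act_Acl]

/-- The optimal value decreases by the stage cost along the undisturbed closed loop. -/
lemma value_drift_le (h : S.IsAdmissible) (hθs : ∀ x ∈ S.feasibleSet, S.IsOptimal x (θs x))
    {x : Vec n} (hx : x ∈ S.feasibleSet) :
    quad S.P (S.drift θs x) + S.excess (S.drift θs x) (θs (S.drift θs x)) ≤
      quad S.P x + S.excess x (θs x) - (quad S.Q x + quad S.R ((θs x).v 0)) := by
  obtain ⟨θ', h1, h2⟩ := exists_shift S x (θs x) 0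
  have h3 := h.feasible_shift (hθs x hx).1 h.zero_mem h1 h2
  rw [act_zero, add_zero] at h3
  have h4 := h.excess_le_of_isOptimal (hθs _ (h.mapsTo_drift hθs hx)) h3
  have h5 := h.excess_shift_le h1 h2
  have h6 := h.step x ((θs x).v 0)
  simp only [drift] at h4 ⊢
  linarith

/-- Adding a multiple of the optimal value to a storage function for detectability yields a bounded
function that decreases quadratically along the undisturbed closed loop. -/
lemma exists_decreasing (h : S.IsAdmissible) (hθs : ∀ x ∈ S.feasibleSet, S.IsOptimal x (θs x))
    {Qh : Matrix (Fin n) (Fin n) ℝ} (hQh : Qh.PosSemidef) (hsq : Qh * Qh = S.Q)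
    (hdet : IsDetectable S.A Qh) :
    ∃ (U : Vec n → ℝ) (Umax γ : ℝ), 0 < γ ∧ (∀ x ∈ S.feasibleSet, 0 ≤ U x) ∧
      (∀ x ∈ S.feasibleSet, U x ≤ Umax) ∧
      ∀ x ∈ S.feasibleSet, U (S.drift θs x) ≤ U x - γ * ‖x‖ ^ 2 := by
  obtain ⟨q, γ, C, Γ, hγ, hΓ, hC, hq1, hqC, hq⟩ := h.exists_storage hQh hsq hdet
  obtain ⟨J, hJ⟩ := h.exists_cost_le
  obtain ⟨ρ, hρ⟩ := h.isCompact_feasibleSet.isBounded.exists_norm_le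
  refine ⟨fun x => q x ^ 2 + Γ * (quad S.P x + S.excess x (θs x)),
    (C * ρ) ^ 2 + Γ * (J - S.N * ∫ y, quad S.P (act S.D y) ∂(S.μ : Measure (Vec p))), γ, hγ,
    fun x hx => ?_, fun x hx => ?_, fun x hx => ?_⟩
  · have h1 := quad_nonneg h.posDef_P.posSemidef x
    have h2 := excess_nonneg h.toIsRiccati x (θs x)
    positivity
  · have h1 : q x ^ 2 ≤ (C * ρ) ^ 2 :=
      pow_le_pow_left₀ ((norm_nonneg x).trans (hq1 x))
        ((hqC x).trans (mul_le_mul_of_nonneg_left (hρ x hx) hC.le)) 2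
    have h2 := hJ x (θs x) (hθs x hx).1
    rw [h.cost_eq] at h2
    exact add_le_add h1 (mul_le_mul_of_nonneg_left (by linarith) hΓ.le)
  · have h1 := hq x ((θs x).v 0)
    have h2 := mul_le_mul_of_nonneg_left (h.value_drift_le hθs hx) hΓ.le
    simp only [drift] at h2 ⊢
    linarith

end Problem.IsAdmissible

end ClosedLoop

end StochMPC

open StochMPC in
theorem mainTheorem10 {n m p : ℕ} (S : StochMPC.Problem n m p)
    -- the horizon is at least one
    (hN : 0 < S.N)
    -- the weights; `Qh` is the positive semidefinite square root of `Q`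
    (Qh : Matrix (Fin n) (Fin n) ℝ)
    (hQ : S.Q.PosSemidef) (hR : S.R.PosDef) (hP : S.P.PosDef)
    (hQh : Qh.PosSemidef) (hQh_sq : Qh * Qh = S.Q)
    (hdetectable : StochMPC.IsDetectable S.A Qh)
    -- `P` and `K` satisfy the algebraic Riccati equation
    (hRiccati : S.P = S.Q + S.Aᵀ * S.P * S.A - S.Kᵀ * (S.R + S.Bᵀ * S.P * S.B) * S.K)
    (hK : S.K = -((S.R + S.Bᵀ * S.P * S.B)⁻¹ * S.Bᵀ * S.P * S.A))
    (hcontrollable : StochMPC.IsControllable (S.A + S.B * S.K) S.D)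
    -- the constraint set
    (hZ_convex : Convex ℝ S.Z) (hZ_compact : IsCompact S.Z)
    (hZ_zero : (0 : StochMPC.Vec n × StochMPC.Vec m) ∈ interior S.Z)
    -- the terminal set is robustly positively invariant under `u = K x` and the constraints
    (hXf_nonempty : S.Xf.Nonempty) (hXf_closed : IsClosed S.Xf)
    (hXf_constraint : ∀ x ∈ S.Xf, (x, StochMPC.act S.K x) ∈ S.Z)
    (hXf_invariant : ∀ x ∈ S.Xf, ∀ w ∈ S.W,
      StochMPC.act S.A x + StochMPC.act S.B (StochMPC.act S.K x) + StochMPC.act S.D w ∈ S.Xf)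
    -- the disturbance set and the law of a disturbance
    (hW_bounded : Bornology.IsBounded S.W) (hW_zero : (0 : StochMPC.Vec p) ∈ interior S.W)
    (hμ_support : ∀ᵐ y ∂(S.μ : Measure (StochMPC.Vec p)), y ∈ S.W)
    (hμ_mean : ∫ y, y ∂(S.μ : Measure (StochMPC.Vec p)) = 0)
    (hμ_nonsingular : ¬ (S.μ : Measure (StochMPC.Vec p)) ⟂ₘ volume)
    (hμ_small : ∀ r : ℝ, 0 < r → 0 < (S.μ : Measure (StochMPC.Vec p)) {y | ‖y‖ ≤ r})
    -- the disturbance sequence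
    {Ω : Type*} [MeasurableSpace Ω] (Pr : Measure Ω) [IsProbabilityMeasure Pr]
    (w : ℕ → Ω → StochMPC.Vec p) (hw_meas : ∀ k, Measurable (w k))
    (hw_indep : iIndepFun w Pr)
    (hw_law : ∀ k, Pr.map (w k) = (S.μ : Measure (StochMPC.Vec p)))
    -- an optimal solution at every feasible state
    (θs : StochMPC.Vec n → StochMPC.Policy m p)
    (hθs : ∀ x ∈ S.feasibleSet, S.IsOptimal x (θs x))
    -- the undisturbed closed-loop map is continuous on the state space
    (hcont : ContinuousOn (S.drift θs) S.feasibleSet) :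
    StochMPC.IsDrift S.feasibleSet (S.drift θs) ∧
    StochMPC.DisturbanceAssumption Pr S.W w ∧
    StochMPC.LinearTerminalMode S.feasibleSet S.W (S.drift θs) S.D S.Xf (S.A + S.B * S.K) ∧
    StochMPC.ISSLyapunovAssumption S.feasibleSet S.W
      (StochMPC.nextState (S.drift θs) S.D) := by
  have hRic : S.IsRiccati := ⟨hQ, hR, hP, hRiccati, hK⟩
  have h : S.IsAdmissible :=
    { hRic with
      horizon_pos := hN
      schur := hRic.isSchurStable hQh hQh_sq hdetectable
      controllable := hcontrollable
      isCompact_Z := hZ_compact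
      nonempty_Xf := hXf_nonempty
      isClosed_Xf := hXf_closed
      constraint_Xf := hXf_constraint
      invariant_Xf := hXf_invariant
      zero_mem_W := hW_zero
      isBounded_W := hW_bounded
      ae_mem_W := hμ_support
      mean_zero := hμ_mean }
  have hdriftXf : ∀ x ∈ S.Xf, S.drift θs x = act S.Acl x := fun x hx => h.drift_eq hθs hx
  have hmapsXf : Set.MapsTo (S.drift θs) S.Xf S.Xf := fun x hx => by
    rw [hdriftXf x hx]; exact h.act_Acl_mem hx
  have hinv := h.isRobustlyInvariant hθs
  have hmaps := h.mapsTo_drift hθs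
  obtain ⟨U, Umax, γ, hγ, hU0, hU1, hU⟩ := h.exists_decreasing hθs hQh hQh_sq hdetectable
  obtain ⟨V, C, hC, hVc, hV1, hV2, hV⟩ := exists_continuous_lyapunov h.isCompact_feasibleSet hmaps
    hcont h.zero_mem_interior_Xf hmapsXf hdriftXf h.schur hγ hU0 hU1 hU
  refine ⟨⟨hmaps, hcont, ?_⟩, ?_, ?_, ?_⟩
  · rw [hdriftXf 0 h.zero_mem_Xf, act_zero]
  · have hmp : ∀ k, MeasurePreserving (w k) Pr (S.μ : Measure (Vec p)) := fun k =>
      ⟨hw_meas k, hw_law k⟩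
    exact
      { measurable := hw_meas
        indep := hw_indep
        identDistrib := fun k => ⟨(hw_meas k).aemeasurable, (hw_meas 0).aemeasurable, by
          rw [hw_law, hw_law]⟩
        integrable := fun k => (hmp k).integrable_comp_of_integrable
          h.isBoundedCentered.integrable_id
        zero_mean := fun k => by
          have := integral_map (μ := Pr) (f := fun y : Vec p => y) (hw_meas k).aemeasurable
            measurable_id.aestronglyMeasurable
          rw [← this, hw_law k, hμ_mean]
        nonsingular := fun k => by rw [hw_law k]; exact hμ_nonsingular
        supported := fun k => (hmp k).quasiMeasurePreserving.ae hμ_support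
        bounded := hW_bounded
        zero_mem_interior := hW_zero
        small_ball := fun k r hr => by
          have := hμ_small r hr
          rwa [← hw_law k, Measure.map_apply (hw_meas k)
            (measurableSet_le measurable_norm measurable_const)] at this }
  · exact
      { subset := h.Xf_subset
        bounded := h.isBounded_Xf
        zero_mem_interior := h.zero_mem_interior_Xf
        robustlyInvariant := fun x hx y hy => by
          rw [nextState, hdriftXf x hx, Problem.act_Acl]
          exact hXf_invariant x hx y hy
        linear := fun x hx y _ => by rw [nextState, hdriftXf x hx]
        schur := h.schur
        controllable := hcontrollable }
  · exact
      { zero_mem_interior := interior_mono h.Xf_subset h.zero_mem_interior_Xf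
        robustlyInvariant := hinv
        exists_lyapunov :=
          ⟨V, isISSLyapunov_of_isCompact h.isCompact_feasibleSet hmaps hinv hC hVc hV1 hV2 hV⟩ }
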